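/- For an $N\times N$ integer matrix $K$, rows and columns indexed by $\{0,\dots,N-1\}$, say that $K$ \emph{defines a metric} if for all indices $i,j,k$: $K[i,j]\ge 0$; $K[i,j]=0$ if and only if $i=j$; $K[i,j]=K[j,i]$; and $K[i,j]\le K[i,k]+K[k,j]$. The machine model is a word RAM with quantum memory. For word length $w$ it has a classical memory of $w$-bit words and a quantum memory of $2^w$ quantum words of $w$ qubits each. A program is a finite text, the same for all $N$, $K$ and $w$, built from elementary instructions and measurements of a quantum word in the computational basis by sequencing, conditionals and while-loops that test a classical word. The elementary instructions are: setting a classical word to a constant, direct and indirect access to classical words, and word arithmetic, bitwise operations, shifts and comparisons on classical words; the Hadamard gate and the gate $\mathrm{diag}(1,e^{i\pi/4})$ on a qubit of a quantum word; xoring a classical word into a quantum word; the reversible gates $|x,y,z\rangle\mapsto|x,y,z\oplus f(x,y)\rangle$ on quantum words, for the word operations $f$; and the oracle gate $|i,j,z\rangle\mapsto|i,j,z\oplus K[i,j]\rangle$, where $K[i,j]$ is written in $w$-bit two's complement (and is replaced by $0$ if $i\ge N$ or $j\ge N$). The quantum words and qubits acted upon are selected by the contents of classical words. Every instruction, oracle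 query, measurement and control-flow step costs one unit of time. Initially one classical word, which also holds the output in the end, contains $N$ (nonzero output means "yes"), and everything else is $0$. \textbf{Theorem.} For every $d\in\mathbb N$ there are a program $P$ and constants $\kappa,C,c\in\mathbb N$ such that the following holds for all $N\ge 1$, all $N\times N$ integer matrices $K$, all $M\in\mathbb N$ with $|K[i,j]|\le M$ for all $i,j$, and all word lengths $w\ge \kappa\,\mathrm{bits}(N)+\mathrm{bits}(M)$, where $\mathrm{bits}(n)$ is the length of $n$ in binary ($\mathrm{bits}(0)=0$). Run on a machine of word length $w$ with an oracle for $K$, the program $P$ halts with probability $1$ within $$\left\lfloor C\, N^{3/2}\,(\log (N+1))^{c}\right\rfloor=\tilde O(N^{1.5})$$ units of time, and with probability at least $1-(N+1)^{-d}$ its output is correct: "yes" if $K$ defines a metric, and "no" if it does not. -/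

import Mathlib

/-! ## A word-RAM with quantum memory

A program is a finite text of a structured imperative language. The machine has a word length `w`,
a classical memory of `w`-bit words, and a quantum memory of `2 ^ w` quantum words of `w` qubits
each. Classical computation controls which elementary quantum operation is applied to which quantum
words; quantum words can be measured at any time. Every elementary operation on words, every
gate, every oracle query, every measurement and every control-flow step costs one unit of time.

One and the same program is run for all sizes of the input and for all word lengths. -/

/-- An `N × N` integer matrix defines a metric on its index set. -/
structure DefinesMetric {N : ℕ} (K : Matrix (Fin N) (Fin N) ℤ) : Prop where
  nonneg : ∀ i j, 0 ≤ K i j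
  eq_zero_iff : ∀ i j, K i j = 0 ↔ i = j
  symm : ∀ i j, K i j = K j i
  triangle : ∀ i j k, K i j ≤ K i k + K k j

namespace QRam

/-- The word operations of the machine. -/
inductive WordOp
  | add | sub | mul | and | or | xor | shl | shr | eq | ult | slt

/-- The value of a word operation; comparisons return the word `0` or `1`. `ult` compares
unsigned values, `slt` compares two's complement values. -/
def WordOp.eval {w : ℕ} : WordOp → BitVec w → BitVec w → BitVec w
  | .add, x, y => x + y
  | .sub, x, y => x - y
  | .mul, x, y => x * y
  | .and, x, y => x &&& y
  | .or, x, y => x ||| y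
  | .xor, x, y => x ^^^ y
  | .shl, x, y => x <<< y.toNat
  | .shr, x, y => x >>> y.toNat
  | .eq, x, y => if x = y then 1#w else 0#w
  | .ult, x, y => if x.ult y then 1#w else 0#w
  | .slt, x, y => if x.slt y then 1#w else 0#w

/-- Elementary deterministic instructions. The arguments `x y z : ℕ` are addresses of classical
words. Below, `c[x]` is the content of the classical word `x`, and `q[x]` is the quantum word
whose address is `c[x]`. -/
inductive Instr
  /-- `c[x] := n` -/
  | const (x n : ℕ)
  /-- `c[z] := op c[x] c[y]` -/
  | arith (op : WordOp) (x y z : ℕ)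
  /-- `c[x] := c[c[y]]` -/
  | load (x y : ℕ)
  /-- `c[c[x]] := c[y]` -/
  | store (x y : ℕ)
  /-- Hadamard gate on the qubit number `c[y]` of `q[x]` -/
  | hadamard (x y : ℕ)
  /-- the gate `diag (1, exp (i π / 4))` on the qubit number `c[y]` of `q[x]` -/
  | phase (x y : ℕ)
  /-- `q[z] := q[z] xor c[x]` -/
  | qconst (x z : ℕ)
  /-- `q[z] := q[z] xor (op q[x] q[y])`, provided that `q[z]` is neither `q[x]` nor `q[y]` -/
  | qarith (op : WordOp) (x y z : ℕ)
  /-- oracle gate `q[z] := q[z] xor K[q[x], q[y]]`, provided that `q[z]` is neither `q[x]`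
  nor `q[y]` -/
  | query (x y z : ℕ)

/-- Programs. -/
inductive Prog
  | instr (a : Instr)
  /-- measure the quantum word `q[y]` in the computational basis, and put the outcome into
  `c[x]` -/
  | measure (x y : ℕ)
  | seq (p q : Prog)
  /-- run `p` if `c[x] ≠ 0`, and run `q` otherwise -/
  | ite (x : ℕ) (p q : Prog)
  /-- run `p` as long as `c[x] ≠ 0` -/
  | loop (x : ℕ) (p : Prog)

/-- Computational basis states of the quantum memory. -/
abbrev Basis (w : ℕ) : Type := BitVec w → BitVec w

/-- A state of the machine: the classical memory, and the amplitudes of the quantum memory. After a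
measurement the amplitudes are not renormalized: the squared norm of `amp` is the probability
of the branch of the computation. -/
structure State (w : ℕ) where
  reg : ℕ → BitVec w
  amp : Basis w → ℂ

/-- The squared norm of a vector of amplitudes. -/
noncomputable def normSq {w : ℕ} (ψ : Basis w → ℂ) : ℝ := ∑ m, ‖ψ m‖ ^ 2

/-- The operator `|m⟩ ↦ |m with cell z replaced by m z xor f m⟩`. It is used only for functions `f`
that do not depend on the cell `z`, so that it is a self-inverse permutation of the basis. -/
def xorInto {w : ℕ} (z : BitVec w) (f : Basis w → BitVec w) (ψ : Basis w → ℂ) : Basis w → ℂ :=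
  fun m => ψ (Function.update m z (m z ^^^ f m))

/-- The Hadamard gate on qubit `b` of the quantum word with address `a`. -/
noncomputable def hadamardGate {w : ℕ} (a : BitVec w) (b : ℕ) (ψ : Basis w → ℂ) : Basis w → ℂ :=
  if b < w then
    fun m =>
      let m' := Function.update m a (m a ^^^ BitVec.twoPow w b)
      (if (m a).getLsbD b then ψ m' - ψ m else ψ m + ψ m') / (Real.sqrt 2 : ℂ)
  else ψ

/-- The gate `diag (1, exp (i π / 4))` on qubit `b` of the quantum word with address `a`. -/
noncomputable def phaseGate {w : ℕ} (a : BitVec w) (b : ℕ) (ψ : Basis w → ℂ) : Basis w → ℂ :=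
  fun m => if (m a).getLsbD b then Complex.exp (Complex.I * Real.pi / 4) * ψ m else ψ m

/-- The word that the oracle for `K` returns on the words `x` and `y`: the `w`-bit two's complement
form of the entry in row `x` and column `y`, the rows and columns being numbered from `0` to
`N - 1`, and `0` if there is no such row or column. -/
def oracleWord {N : ℕ} (K : Matrix (Fin N) (Fin N) ℤ) {w : ℕ} (x y : BitVec w) : BitVec w :=
  if h : x.toNat < N ∧ y.toNat < N then BitVec.ofInt w (K ⟨x.toNat, h.1⟩ ⟨y.toNat, h.2⟩) else 0#w

/-- The effect of an elementary instruction, the oracle being that for `K`. -/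
noncomputable def Instr.exec {N : ℕ} (K : Matrix (Fin N) (Fin N) ℤ) {w : ℕ} (σ : State w) :
    Instr → State w
  | .const x n => { σ with reg := Function.update σ.reg x (BitVec.ofNat w n) }
  | .arith op x y z =>
      { σ with reg := Function.update σ.reg z (op.eval (σ.reg x) (σ.reg y)) }
  | .load x y => { σ with reg := Function.update σ.reg x (σ.reg (σ.reg y).toNat) }
  | .store x y => { σ with reg := Function.update σ.reg (σ.reg x).toNat (σ.reg y) }
  | .hadamard x y => { σ with amp := hadamardGate (σ.reg x) (σ.reg y).toNat σ.amp }
  | .phase x y => { σ with amp := phaseGate (σ.reg x) (σ.reg y).toNat σ.amp }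
  | .qconst x z => { σ with amp := xorInto (σ.reg z) (fun _ => σ.reg x) σ.amp }
  | .qarith op x y z =>
      if σ.reg z ≠ σ.reg x ∧ σ.reg z ≠ σ.reg y then
        { σ with amp := xorInto (σ.reg z) (fun m => op.eval (m (σ.reg x)) (m (σ.reg y))) σ.amp }
      else σ
  | .query x y z =>
      if σ.reg z ≠ σ.reg x ∧ σ.reg z ≠ σ.reg y then
        { σ with amp := xorInto (σ.reg z) (fun m => oracleWord K (m (σ.reg x)) (m (σ.reg y))) σ.amp }
      else σ

/-- The branch of the state `σ` in which the measurement of the quantum word `q[y]` has the outcome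
`v`, which is stored in `c[x]`. -/
def State.measured {w : ℕ} (σ : State w) (x y : ℕ) (v : BitVec w) : State w where
  reg := Function.update σ.reg x v
  amp := fun m => if m (σ.reg y) = v then σ.amp m else 0

/-- `outProb K out t l σ` is the probability that, with an oracle for `K` and from the state `σ`,
running the programs of the list `l` one after the other halts within `t` units of time with
output `out`. The output is `true` if the classical word `0` is nonzero in the end, and `false`
if it is zero. -/
noncomputable def outProb {N : ℕ} (K : Matrix (Fin N) (Fin N) ℤ) {w : ℕ} (out : Bool) :
    ℕ → List Prog → State w → ℝ
  | _, [], σ => if decide (σ.reg 0 ≠ 0#w) = out then normSq σ.amp else 0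
  | 0, _ :: _, _ => 0
  | t + 1, .instr a :: l, σ => outProb K out t l (a.exec K σ)
  | t + 1, .measure x y :: l, σ => ∑ v : BitVec w, outProb K out t l (σ.measured x y v)
  | t + 1, .seq p q :: l, σ => outProb K out t (p :: q :: l) σ
  | t + 1, .ite x p q :: l, σ =>
      if σ.reg x ≠ 0#w then outProb K out t (p :: l) σ else outProb K out t (q :: l) σ
  | t + 1, .loop x p :: l, σ =>
      if σ.reg x ≠ 0#w then outProb K out t (p :: .loop x p :: l) σ else outProb K out t l σ

/-- The initial state: the classical word `0` holds the size `N`, and everything else is `0`. -/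
def initial (w N : ℕ) : State w where
  reg := Function.update (fun _ => 0#w) 0 (BitVec.ofNat w N)
  amp := fun m => if m = fun _ => 0#w then 1 else 0

/-- The probability that the program `P`, on a machine of word length `w` with an oracle for the
`N × N` matrix `K`, halts within `t` units of time with output `out`. -/
noncomputable def runProb {N : ℕ} (P : Prog) (w : ℕ) (K : Matrix (Fin N) (Fin N) ℤ) (t : ℕ)
    (out : Bool) : ℝ :=
  outProb K out t [P] (initial w N)

end QRam

/-! A failure of the metric axioms is witnessed by one triple of indices. With `h = Nat.log 4 N +
1`, so that `N < 4 ^ h ≤ 4 * N`, a triple is packed into `6 * h` bits, and Grover search over these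
`64 ^ h` words needs about `8 ^ h ≤ 8 * N ^ (3 / 2)` steps, each of cost `O(h)`.

If `sin θ ^ 2` is the fraction of violating words, then `j` steps followed by a measurement find one
with probability `sin ((2 * j + 1) * θ) ^ 2` (`groverStep_searchAmp`, `sum_searchAmp`). As `θ` is
unknown, a sweep tries `j = 2 ^ s - 1` for all `s ≤ 3 * h`. The angle at most triples from one `s`
to the next, so it cannot jump over the interval from `π / 4` to `3 * π / 4`, and some round
succeeds with probability at least one half (`exists_half_le_sin_sq`). After `2 * h * d` sweeps the
failure probability is at most `4 ^ (-h * d) ≤ (N + 1) ^ (-d)`. A metric has no violating word; then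
`θ = 0` and the answer is always right (`prod_failProb_eq_one`).

On the machine, the violation predicate is computed reversibly into scratch words, used as a phase
and uncomputed (`execList_kick_emb`, `badOps_spec`). The reflection about the uniform superposition
is a sign flip at zero conjugated by Hadamard gates (`up_flip_down`). Each round ends with
measurements that return the quantum memory to the zero state up to a scalar, so failure
probabilities multiply; `HasVal` carries this product backwards through the program, from
`hasVal_final` to `hasVal_outer`. The running time does not depend on measurement outcomes, which
makes it an explicit function of `h` and `d`. -/

namespace QRam

/-! ### Deterministic execution -/

/-- `p` runs from `σ` to `σ'` in exactly `n` units of time, without measurements. -/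
def Exec {N : ℕ} (K : Matrix (Fin N) (Fin N) ℤ) {w : ℕ} (p : Prog) (n : ℕ) (σ σ' : State w) : Prop :=
  ∀ (out : Bool) (t : ℕ) (l : List Prog), outProb K out (t + n) (p :: l) σ = outProb K out t l σ'

/-- The instructions of `l` one after the other, and then `p`. -/
def block (l : List Instr) (p : Prog) : Prog := l.foldr (fun a q => .seq (.instr a) q) p

noncomputable def execList {N : ℕ} (K : Matrix (Fin N) (Fin N) ℤ) {w : ℕ} (l : List Instr) (σ : State w) :
    State w :=
  l.foldl (fun σ a => a.exec K σ) σ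

section
variable {N : ℕ} {K : Matrix (Fin N) (Fin N) ℤ} {w : ℕ}

theorem exec_instr (a : Instr) (σ : State w) : Exec K (.instr a) 1 σ (a.exec K σ) := by
  intro out t l
  simp [outProb]

theorem Exec.seq {p q : Prog} {n m : ℕ} {σ σ' σ'' : State w} (hp : Exec K p n σ σ')
    (hq : Exec K q m σ' σ'') : Exec K (.seq p q) (n + m + 1) σ σ'' := by
  intro out t l
  rw [← add_assoc, outProb, ← hq out t l, ← hp out (t + m) (q :: l)]
  congr 1
  omega

theorem exec_loop_done {x : ℕ} {p : Prog} {σ : State w} (h : σ.reg x = 0#w) :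
    Exec K (.loop x p) 1 σ σ := by
  intro out t l
  simp [outProb, h]

theorem exec_loop_step {x : ℕ} {p : Prog} {n m : ℕ} {σ σ' σ'' : State w} (h : σ.reg x ≠ 0#w)
    (hp : Exec K p n σ σ') (hl : Exec K (.loop x p) m σ' σ'') :
    Exec K (.loop x p) (n + m + 1) σ σ'' := by
  intro out t l
  rw [← add_assoc, outProb, if_pos h, ← hl out t l, ← hp out (t + m)]
  congr 1
  omega

/-- The invariant is indexed by the number of completed passes. Each pass pays one unit for the loop
test, and the last `+ 1` is the test that leaves the loop. -/
theorem exec_loop {x : ℕ} {p : Prog} (I : ℕ → State w → Prop) (k τ : ℕ)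
    (hstep : ∀ i < k, ∀ σ, I i σ → σ.reg x ≠ 0#w ∧ ∃ σ', Exec K p τ σ σ' ∧ I (i + 1) σ')
    (hend : ∀ σ, I k σ → σ.reg x = 0#w) (σ : State w) (h0 : I 0 σ) :
    ∃ σ', Exec K (.loop x p) (k * (τ + 1) + 1) σ σ' ∧ I k σ' := by
  suffices H : ∀ r i, i + r = k → ∀ σ, I i σ →
      ∃ σ', Exec K (.loop x p) (r * (τ + 1) + 1) σ σ' ∧ I k σ' from H k 0 (by omega) σ h0
  intro r
  induction r with
  | zero =>
    intro i hi σ hI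
    obtain rfl : i = k := by omega
    exact ⟨σ, by simpa using exec_loop_done (hend σ hI), hI⟩
  | succ r ih =>
    intro i hi σ hI
    obtain ⟨hx, σ', he, hI'⟩ := hstep i (by omega) σ hI
    obtain ⟨σ'', he', hI''⟩ := ih (i + 1) (by omega) σ' hI'
    refine ⟨σ'', ?_, hI''⟩
    have := exec_loop_step hx he he'
    convert this using 1
    ring

/-- Each instruction of a block costs two units: one for the sequencing node and one for itself. -/
theorem outProb_block (out : Bool) (t : ℕ) (a : List Instr) (p : Prog) (l : List Prog) (σ : State w) :
    outProb K out (t + 2 * a.length) (block a p :: l) σ =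
      outProb K out t (p :: l) (execList K a σ) := by
  induction a generalizing σ with
  | nil => rfl
  | cons a as ih =>
    rw [List.length_cons, show t + 2 * (as.length + 1) = (t + 2 * as.length) + 1 + 1 by ring]
    exact ih (a.exec K σ)

theorem Exec.block {a : List Instr} {p : Prog} {n : ℕ} {σ σ' : State w}
    (hp : Exec K p n (execList K a σ) σ') : Exec K (block a p) (n + 2 * a.length) σ σ' := by
  intro out t l
  rw [← add_assoc, outProb_block]
  exact hp out t l

theorem exec_block_instr (a : List Instr) (b : Instr) (σ : State w) :
    Exec K (QRam.block a (.instr b)) (1 + 2 * a.length) σ (b.exec K (execList K a σ)) :=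
  (exec_instr b _).block

theorem execList_append (a b : List Instr) (σ : State w) :
    execList K (a ++ b) σ = execList K b (execList K a σ) := by
  simp [execList]

end

/-! ### Frame conditions for the classical memory. -/

/-- The register files `ρ` and `ρ'` agree outside of the registers in `s`. -/
def EqOff {w : ℕ} (s : Finset ℕ) (ρ ρ' : ℕ → BitVec w) : Prop := ∀ r, r ∉ s → ρ' r = ρ r

theorem EqOff.refl {w : ℕ} (s : Finset ℕ) (ρ : ℕ → BitVec w) : EqOff s ρ ρ := fun _ _ => rfl

theorem EqOff.trans {w : ℕ} {s : Finset ℕ} {ρ ρ' ρ'' : ℕ → BitVec w} (h : EqOff s ρ ρ')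
    (h' : EqOff s ρ' ρ'') : EqOff s ρ ρ'' := fun r hr => (h' r hr).trans (h r hr)

theorem EqOff.mono {w : ℕ} {s s' : Finset ℕ} {ρ ρ' : ℕ → BitVec w} (h : EqOff s ρ ρ')
    (hs : s ⊆ s') : EqOff s' ρ ρ' := fun r hr => h r (fun h' => hr (hs h'))

theorem EqOff.update {w : ℕ} {s : Finset ℕ} {ρ ρ' : ℕ → BitVec w} (h : EqOff s ρ ρ') {r : ℕ}
    (hr : r ∈ s) (v : BitVec w) : EqOff s ρ (Function.update ρ' r v) := by
  intro r' hr'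
  rw [Function.update_of_ne (by rintro rfl; exact hr' hr)]
  exact h r' hr'

end QRam
namespace QRam

/-! ### Hadamard gates on one quantum word -/

/-- The memory with `x` in the quantum word `0` and `0` elsewhere. -/
def embed {w : ℕ} (x : BitVec w) : Basis w := Function.update (fun _ => 0#w) 0#w x

/-- The amplitudes of the quantum memory with amplitudes `φ` for the quantum word `0`, and zero in
the other words. -/
noncomputable def emb {w : ℕ} (φ : BitVec w → ℂ) : Basis w → ℂ :=
  fun m => if m = embed (m 0#w) then φ (m 0#w) else 0

/-- The Hadamard gate on qubit `b` of a single quantum word. -/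
noncomputable def had {w : ℕ} (b : ℕ) (φ : BitVec w → ℂ) : BitVec w → ℂ := fun x =>
  (if x.getLsbD b then φ (x ^^^ BitVec.twoPow w b) - φ x else φ x + φ (x ^^^ BitVec.twoPow w b)) /
    (Real.sqrt 2 : ℂ)

/-- Hadamard gates on the qubits `L - 1, …, 0`, in this order. -/
noncomputable def down {w : ℕ} : ℕ → (BitVec w → ℂ) → BitVec w → ℂ
  | 0, φ => φ
  | b + 1, φ => down b (had b φ)

/-- Hadamard gates on the qubits `0, …, L - 1`, in this order. -/
noncomputable def up {w : ℕ} : ℕ → (BitVec w → ℂ) → BitVec w → ℂ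
  | 0, φ => φ
  | b + 1, φ => had b (up b φ)

/-- The uniform superposition of the words below `2 ^ L`. -/
noncomputable def unif {w : ℕ} (L : ℕ) : BitVec w → ℂ := fun x =>
  if x.toNat < 2 ^ L then 1 / (Real.sqrt 2 : ℂ) ^ L else 0

section
variable {w : ℕ}

@[simp] theorem embed_zero_apply (x : BitVec w) : embed x 0#w = x := by simp [embed]

theorem embed_apply_of_ne (x : BitVec w) {a : BitVec w} (h : a ≠ 0#w) : embed x a = 0#w := by
  simp [embed, h]

/-- Both sides only say that all words other than word `0` vanish. Hence gates on word `0` preserve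
the form `emb φ`. -/
theorem update_eq_embed_iff (m : Basis w) (x : BitVec w) :
    Function.update m 0#w x = embed x ↔ m = embed (m 0#w) := by
  constructor
  · intro h
    have := congrArg (fun f => Function.update f 0#w (m 0#w)) h
    simpa [embed] using this
  · intro h
    have := congrArg (fun f => Function.update f 0#w x) h
    simpa [embed] using this

theorem hadamardGate_emb {b : ℕ} (hb : b < w) (φ : BitVec w → ℂ) :
    hadamardGate 0#w b (emb φ) = emb (had b φ) := by
  funext m
  simp only [hadamardGate, if_pos hb, emb, had, Function.update_self]
  simp only [update_eq_embed_iff m _]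
  by_cases h : m = embed (m 0#w)
  · simp only [if_pos h]
  · simp only [if_neg h]
    simp

theorem xorInto_emb (v : BitVec w) (φ : BitVec w → ℂ) :
    xorInto 0#w (fun _ => v) (emb φ) = emb (fun x => φ (x ^^^ v)) := by
  funext m
  simp only [xorInto, emb, Function.update_self]
  simp only [update_eq_embed_iff m _]

theorem emb_embed (φ : BitVec w → ℂ) (x : BitVec w) : emb φ (embed x) = φ x := by
  simp [emb]

theorem getLsbD_xor_twoPow {b : ℕ} (hb : b < w) (x : BitVec w) :
    (x ^^^ BitVec.twoPow w b).getLsbD b = !x.getLsbD b := by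
  simp [hb]

theorem xor_twoPow_xor_twoPow (x : BitVec w) (b : ℕ) :
    x ^^^ BitVec.twoPow w b ^^^ BitVec.twoPow w b = x := by
  rw [BitVec.xor_assoc, BitVec.xor_self, BitVec.xor_zero]

theorem toNat_xor_twoPow_lt {b : ℕ} (hb : b < w) (x : BitVec w) :
    (x ^^^ BitVec.twoPow w b).toNat < 2 ^ (b + 1) ↔ x.toNat < 2 ^ (b + 1) := by
  -- Flipping bit `b` is invisible after shifting out the `b + 1` lowest bits.
  have key : (x ^^^ BitVec.twoPow w b).toNat >>> (b + 1) = x.toNat >>> (b + 1) := by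
    rw [BitVec.toNat_xor, Nat.shiftRight_xor_distrib, BitVec.toNat_twoPow_of_lt hb]
    have : 2 ^ b >>> (b + 1) = 0 := by
      rw [Nat.shiftRight_eq_div_pow]
      exact Nat.div_eq_of_lt (Nat.pow_lt_pow_right (by norm_num) (by omega))
    rw [this, Nat.xor_zero]
  rw [Nat.shiftRight_eq_div_pow, Nat.shiftRight_eq_div_pow] at key
  rw [← Nat.div_eq_zero_iff_lt (by positivity), ← Nat.div_eq_zero_iff_lt (by positivity), key]

theorem toNat_lt_two_pow_iff (b : ℕ) (x : BitVec w) :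
    x.toNat < 2 ^ b ↔ x.toNat < 2 ^ (b + 1) ∧ x.getLsbD b = false := by
  rw [BitVec.getLsbD, Nat.testBit_eq_decide_div_mod_eq, ← Nat.div_eq_zero_iff_lt (by positivity),
    ← Nat.div_eq_zero_iff_lt (by positivity), pow_succ, ← Nat.div_div_eq_div_mul]
  simp only [decide_eq_false_iff_not]
  omega

theorem sqrt_two_ne_zero : (Real.sqrt 2 : ℂ) ≠ 0 := by
  exact_mod_cast (Real.sqrt_pos.2 two_pos).ne'

theorem sqrt_two_mul_self : (Real.sqrt 2 : ℂ) * (Real.sqrt 2 : ℂ) = 2 := by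
  exact_mod_cast Real.mul_self_sqrt two_pos.le

theorem had_had {b : ℕ} (hb : b < w) (φ : BitVec w → ℂ) : had b (had b φ) = φ := by
  funext x
  have h2 := sqrt_two_ne_zero
  have h22 := sqrt_two_mul_self
  simp only [had, getLsbD_xor_twoPow hb, xor_twoPow_xor_twoPow]
  cases h : x.getLsbD b <;> simp <;> field_simp <;> linear_combination (-φ x) * h22

theorem had_sub_smul (b : ℕ) (φ χ : BitVec w → ℂ) (c : ℂ) :
    had b (fun x => φ x - c * χ x) = fun x => had b φ x - c * had b χ x := by
  funext x
  simp only [had]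
  split_ifs <;> ring

theorem up_sub_smul (b : ℕ) (φ χ : BitVec w → ℂ) (c : ℂ) :
    up b (fun x => φ x - c * χ x) = fun x => up b φ x - c * up b χ x := by
  induction b with
  | zero => rfl
  | succ b ih => rw [up, ih, had_sub_smul]; rfl

/-- The two orders of gates are opposite, so the involutions cancel from the inside out. -/
theorem up_down {L : ℕ} (hL : L ≤ w) (φ : BitVec w → ℂ) : up L (down L φ) = φ := by
  induction L generalizing φ with
  | zero => rfl
  | succ b ih => rw [up, down, ih (by omega), had_had (by omega)]

theorem had_unif {b : ℕ} (hb : b < w) : had b (unif b) = unif (w := w) (b + 1) := by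
  funext x
  have h2 := sqrt_two_ne_zero
  simp only [had, unif, toNat_lt_two_pow_iff b, getLsbD_xor_twoPow hb, toNat_xor_twoPow_lt hb]
  rw [pow_succ (Real.sqrt 2 : ℂ)]
  cases h : x.getLsbD b <;> by_cases h' : x.toNat < 2 ^ (b + 1) <;> simp [h'] <;> field_simp

theorem up_delta {L : ℕ} (hL : L ≤ w) :
    up L (fun x => if x = 0#w then 1 else 0) = unif (w := w) L := by
  induction L with
  | zero =>
    funext x
    simp [up, unif, BitVec.toNat_eq]
  | succ b ih => rw [up, ih (by omega), had_unif (by omega)]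

/-- The words below `2 ^ L`. -/
def below (w L : ℕ) : Finset (BitVec w) := {x | x.toNat < 2 ^ L}

theorem mem_below {L : ℕ} {x : BitVec w} : x ∈ below w L ↔ x.toNat < 2 ^ L := by simp [below]

/-- Pair each word with the one differing in bit `b`: at the member with bit `b` clear, the gate
yields the sum over the pair, divided by `√2`. -/
theorem sum_below_had {b : ℕ} (hb : b < w) (φ : BitVec w → ℂ) :
    ∑ x ∈ below w b, had b φ x = (∑ x ∈ below w (b + 1), φ x) / (Real.sqrt 2 : ℂ) := by
  have hfalse : (below w (b + 1)).filter (fun x => ¬ x.getLsbD b = true) = below w b := by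
    ext x
    rw [Finset.mem_filter, mem_below, mem_below, toNat_lt_two_pow_iff b, Bool.not_eq_true]
  have htrue : ∑ x ∈ (below w (b + 1)).filter (fun x => x.getLsbD b = true), φ x =
      ∑ x ∈ below w b, φ (x ^^^ BitVec.twoPow w b) := by
    refine Finset.sum_nbij' (fun x => x ^^^ BitVec.twoPow w b) (fun x => x ^^^ BitVec.twoPow w b)
      ?_ ?_ ?_ ?_ ?_
    · intro x hx
      rw [Finset.mem_filter, mem_below] at hx
      rw [mem_below, toNat_lt_two_pow_iff, toNat_xor_twoPow_lt hb, getLsbD_xor_twoPow hb]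
      simp [hx]
    · intro x hx
      rw [mem_below, toNat_lt_two_pow_iff] at hx
      rw [Finset.mem_filter, mem_below, toNat_xor_twoPow_lt hb, getLsbD_xor_twoPow hb]
      simp [hx]
    · intro x _; exact xor_twoPow_xor_twoPow x b
    · intro x _; exact xor_twoPow_xor_twoPow x b
    · intro x _; rw [xor_twoPow_xor_twoPow]
  rw [← Finset.sum_filter_add_sum_filter_not (below w (b + 1)) (fun x : BitVec w => x.getLsbD b = true), htrue,
    hfalse, ← Finset.sum_add_distrib, Finset.sum_div]
  refine Finset.sum_congr rfl fun x hx => ?_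
  rw [mem_below, toNat_lt_two_pow_iff] at hx
  simp only [had, hx.2]
  simp [add_comm]

/-- This is the inner product with the uniform superposition, which is what the sign flip at zero
reads off. -/
theorem down_apply_zero {L : ℕ} (hL : L ≤ w) (φ : BitVec w → ℂ) :
    down L φ 0#w = (∑ x ∈ below w L, φ x) / (Real.sqrt 2 : ℂ) ^ L := by
  induction L generalizing φ with
  | zero =>
    have : below w 0 = {0#w} := by
      ext x
      simp [mem_below, BitVec.toNat_eq]
    simp [down, this]
  | succ b ih =>
    rw [down, ih (by omega), sum_below_had (by omega), pow_succ', div_div]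

/-- The reflection about the uniform superposition. -/
theorem up_flip_down {L : ℕ} (hL : L ≤ w) (φ : BitVec w → ℂ) :
    up L (fun x => (if x = 0#w then -1 else 1) * down L φ x) =
      fun x => φ x - 2 * (if x.toNat < 2 ^ L then (∑ y ∈ below w L, φ y) / 2 ^ L else 0) := by
  -- The sign flip subtracts twice the component at zero; by linearity `up` sends that component to
  -- a multiple of `unif L`.
  have h : (fun x => (if x = 0#w then (-1 : ℂ) else 1) * down L φ x) =
      fun x => down L φ x - 2 * down L φ 0#w * (if x = 0#w then 1 else 0) := by
    funext x
    by_cases hx : x = 0#w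
    · simp [hx]; ring
    · simp [hx]
  rw [h, up_sub_smul, up_down hL, up_delta hL, down_apply_zero hL]
  funext x
  simp only [unif]
  have h2 : (2 : ℂ) ^ L = (Real.sqrt 2 : ℂ) ^ L * (Real.sqrt 2 : ℂ) ^ L := by
    rw [← mul_pow, sqrt_two_mul_self]
  have h3 : (Real.sqrt 2 : ℂ) ^ L ≠ 0 := pow_ne_zero _ sqrt_two_ne_zero
  split_ifs
  · rw [h2]; field_simp
  · ring

end
end QRam
namespace QRam

/-! ### Reversible computation on quantum words -/

/-- Reversible operations on the quantum words with small addresses; the classical word `100 + k` is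
supposed to hold the address `k`. -/
inductive QOp
  | cst (r z : ℕ)
  | op (o : WordOp) (a b z : ℕ)
  | qry (a b z : ℕ)

def QOp.toInstr : QOp → Instr
  | .cst r z => .qconst r (100 + z)
  | .op o a b z => .qarith o (100 + a) (100 + b) (100 + z)
  | .qry a b z => .query (100 + a) (100 + b) (100 + z)

def QOp.target : QOp → ℕ
  | .cst _ z => z
  | .op _ _ _ z => z
  | .qry _ _ z => z

def QOp.args : QOp → List ℕ
  | .cst _ _ => []
  | .op _ a b _ => [a, b]
  | .qry a b _ => [a, b]

def QOp.val {N : ℕ} (K : Matrix (Fin N) (Fin N) ℤ) {w : ℕ} (ρ : ℕ → BitVec w) (m : Basis w) :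
    QOp → BitVec w
  | .cst r _ => ρ r
  | .op o a b _ => o.eval (m (BitVec.ofNat w a)) (m (BitVec.ofNat w b))
  | .qry a b _ => oracleWord K (m (BitVec.ofNat w a)) (m (BitVec.ofNat w b))

def QOp.act {N : ℕ} (K : Matrix (Fin N) (Fin N) ℤ) {w : ℕ} (ρ : ℕ → BitVec w) (o : QOp)
    (m : Basis w) : Basis w :=
  Function.update m (BitVec.ofNat w o.target) (m (BitVec.ofNat w o.target) ^^^ o.val K ρ m)

def qrun {N : ℕ} (K : Matrix (Fin N) (Fin N) ℤ) {w : ℕ} (ρ : ℕ → BitVec w) (ops : List QOp)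
    (m : Basis w) : Basis w :=
  ops.foldl (fun m o => o.act K ρ m) m

/-- The target of the operation is not among its arguments, and all addresses are small. -/
def QOp.WF (o : QOp) : Prop := o.target < 64 ∧ ∀ a ∈ o.args, a < 64 ∧ a ≠ o.target

/-- The targets are `i, i + 1, …`, and all arguments have been computed before. -/
def SSA : ℕ → List QOp → Prop
  | _, [] => True
  | i, o :: os => o.target = i ∧ i < 64 ∧ (∀ a ∈ o.args, a < i) ∧ SSA (i + 1) os

/-- The classical word `100 + k` holds `k`, for all small `k`. -/
def Addr {w : ℕ} (ρ : ℕ → BitVec w) : Prop := ∀ k < 64, ρ (100 + k) = BitVec.ofNat w k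

/-- Change the sign of the basis states for which `ops` computes a word with lowest bit `1` in the
quantum word `z`. -/
def kick (ops : List QOp) (z : ℕ) : List Instr :=
  ops.map QOp.toInstr ++ (List.replicate 4 (.phase (100 + z) 100) ++ ops.reverse.map QOp.toInstr)

section
variable {N : ℕ} {K : Matrix (Fin N) (Fin N) ℤ} {w : ℕ} {ρ : ℕ → BitVec w}

theorem ofNat_ne_ofNat (hw : 6 ≤ w) {a b : ℕ} (ha : a < 64) (hb : b < 64) (h : a ≠ b) :
    BitVec.ofNat w a ≠ BitVec.ofNat w b := by
  have h64 : 64 ≤ 2 ^ w := le_trans (by norm_num) (Nat.pow_le_pow_right two_pos hw)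
  intro h'
  apply h
  have := congrArg BitVec.toNat h'
  rwa [BitVec.toNat_ofNat, BitVec.toNat_ofNat, Nat.mod_eq_of_lt (by omega),
    Nat.mod_eq_of_lt (by omega)] at this

theorem QOp.val_congr (o : QOp) {m m' : Basis w}
    (h : ∀ a ∈ o.args, m (BitVec.ofNat w a) = m' (BitVec.ofNat w a)) :
    o.val K ρ m = o.val K ρ m' := by
  cases o <;> simp_all [QOp.val, QOp.args]

/-- The target is not an argument, so the second application xors in the same value again. -/
theorem QOp.act_act (hw : 6 ≤ w) {o : QOp} (ho : o.WF) (m : Basis w) :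
    o.act K ρ (o.act K ρ m) = m := by
  have h : o.val K ρ (o.act K ρ m) = o.val K ρ m := by
    refine o.val_congr fun a ha => ?_
    rw [QOp.act, Function.update_of_ne]
    exact ofNat_ne_ofNat hw (ho.2 a ha).1 ho.1 (ho.2 a ha).2
  rw [QOp.act, h, QOp.act, Function.update_self, Function.update_idem, BitVec.xor_assoc,
    BitVec.xor_self, BitVec.xor_zero, Function.update_eq_self]

theorem QOp.exec_eq (hw : 6 ≤ w) {o : QOp} (ho : o.WF) (σ : State w) (hσ : Addr σ.reg) :
    o.toInstr.exec K σ = ⟨σ.reg, fun m => σ.amp (o.act K σ.reg m)⟩ := by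
  obtain ⟨ht, ha⟩ := ho
  cases o with
  | cst r z =>
    simp only [QOp.target] at ht
    simp only [QOp.toInstr, Instr.exec, hσ z ht]
    rfl
  | op o a b z =>
    simp only [QOp.target, QOp.args, List.mem_cons, List.not_mem_nil, or_false, forall_eq_or_imp,
      forall_eq] at ht ha
    simp only [QOp.toInstr, Instr.exec, hσ z ht, hσ a ha.1.1, hσ b ha.2.1]
    rw [if_pos ⟨ofNat_ne_ofNat hw ht ha.1.1 ha.1.2.symm, ofNat_ne_ofNat hw ht ha.2.1 ha.2.2.symm⟩]
    rfl
  | qry a b z =>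
    simp only [QOp.target, QOp.args, List.mem_cons, List.not_mem_nil, or_false, forall_eq_or_imp,
      forall_eq] at ht ha
    simp only [QOp.toInstr, Instr.exec, hσ z ht, hσ a ha.1.1, hσ b ha.2.1]
    rw [if_pos ⟨ofNat_ne_ofNat hw ht ha.1.1 ha.1.2.symm, ofNat_ne_ofNat hw ht ha.2.1 ha.2.2.symm⟩]
    rfl

theorem qrun_append (a b : List QOp) (m : Basis w) :
    qrun K ρ (a ++ b) m = qrun K ρ b (qrun K ρ a m) := by
  simp [qrun]

theorem qrun_reverse_qrun (hw : 6 ≤ w) {ops : List QOp} (h : ∀ o ∈ ops, o.WF) (m : Basis w) :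
    qrun K ρ ops.reverse (qrun K ρ ops m) = m := by
  induction ops generalizing m with
  | nil => rfl
  | cons o os ih =>
    rw [List.reverse_cons, qrun_append]
    change QOp.act K ρ o (qrun K ρ os.reverse (qrun K ρ os (o.act K ρ m))) = m
    rw [ih (fun o ho => h o (List.mem_cons_of_mem _ ho)), QOp.act_act hw (h o List.mem_cons_self)]

/-- Amplitudes are pulled back along each operation, and pulling back reverses the order of
composition. -/
theorem execList_qops (hw : 6 ≤ w) {ops : List QOp} (h : ∀ o ∈ ops, o.WF) (σ : State w)
    (hσ : Addr σ.reg) :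
    execList K (ops.map QOp.toInstr) σ =
      ⟨σ.reg, fun m => σ.amp (qrun K σ.reg ops.reverse m)⟩ := by
  induction ops generalizing σ with
  | nil => rfl
  | cons o os ih =>
    change execList K (os.map QOp.toInstr) (o.toInstr.exec K σ) = _
    rw [QOp.exec_eq hw (h o List.mem_cons_self) σ hσ,
      ih (fun o ho => h o (List.mem_cons_of_mem _ ho)) _ (by exact hσ)]
    simp only [List.reverse_cons, qrun_append]
    rfl

/-- The fourth power of `exp (i π / 4)` is `-1`, so four phase gates make a sign flip. -/
theorem execList_phases (x y : ℕ) (σ : State w) :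
    execList K (List.replicate 4 (.phase x y)) σ =
      ⟨σ.reg, fun m =>
        (if (m (σ.reg x)).getLsbD (σ.reg y).toNat then -1 else 1) * σ.amp m⟩ := by
  have h : Complex.exp (Complex.I * Real.pi / 4) ^ 4 = -1 := by
    rw [← Complex.exp_nat_mul, ← Complex.exp_pi_mul_I]
    congr 1
    push_cast
    ring
  simp only [execList, List.replicate, List.foldl, Instr.exec]
  congr 1
  funext m
  simp only [phaseGate]
  split_ifs
  · rw [← h]; ring
  · ring

/-- Compute, flip the sign, uncompute: the reversed list undoes the computation, so only the sign
survives. The classical word `100` holds `0` and so selects the lowest qubit. -/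
theorem execList_kick (hw : 6 ≤ w) {ops : List QOp} (h : ∀ o ∈ ops, o.WF) {z : ℕ} (hz : z < 64)
    (σ : State w) (hσ : Addr σ.reg) :
    execList K (kick ops z) σ = ⟨σ.reg, fun m =>
      (if (qrun K σ.reg ops m (BitVec.ofNat w z)).getLsbD 0 then -1 else 1) * σ.amp m⟩ := by
  have h' : ∀ o ∈ ops.reverse, o.WF := fun o ho => h o (List.mem_reverse.1 ho)
  rw [kick, execList_append, execList_append, execList_qops hw h σ hσ, execList_phases,
    execList_qops hw h' _ (by exact hσ)]
  have h0 : σ.reg 100 = 0#w := hσ 0 (by norm_num)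
  simp only [List.reverse_reverse, qrun_reverse_qrun hw h, hσ z hz, h0]
  rfl

theorem SSA.wf {i : ℕ} {ops : List QOp} (h : SSA i ops) : ∀ o ∈ ops, o.WF := by
  induction ops generalizing i with
  | nil => simp
  | cons o os ih =>
    obtain ⟨ht, hi, ha, hs⟩ := h
    intro o' ho'
    rcases List.mem_cons.1 ho' with rfl | ho'
    · refine ⟨by omega, fun a haa => ?_⟩
      have := ha a haa
      omega
    · exact ih hs o' ho'

/-- Each scratch word starts at zero and is written once, so xoring acts as assignment. No argument
changes after it has been read, so all the defining equations hold simultaneously in the final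
state. -/
theorem SSA.spec (hw : 6 ≤ w) {i : ℕ} {ops : List QOp} (h : SSA i ops) (m : Basis w)
    (hm : ∀ k, i ≤ k → k < 64 → m (BitVec.ofNat w k) = 0#w) (hi : i ≤ 64) :
    (∀ k < i, qrun K ρ ops m (BitVec.ofNat w k) = m (BitVec.ofNat w k)) ∧
      ∀ o ∈ ops, qrun K ρ ops m (BitVec.ofNat w o.target) = o.val K ρ (qrun K ρ ops m) := by
  induction ops generalizing i m with
  | nil => exact ⟨fun _ _ => rfl, by simp⟩
  | cons o os ih =>
    obtain ⟨ht, hi', ha, hs⟩ := h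
    have hne : ∀ k < 64, k ≠ i → o.act K ρ m (BitVec.ofNat w k) = m (BitVec.ofNat w k) := by
      intro k hk hki
      rw [QOp.act, Function.update_of_ne]
      exact ofNat_ne_ofNat hw hk (by omega) (by omega)
    have key := ih hs (o.act K ρ m) (fun k hk hk' => by
      rw [hne k hk' (by omega)]; exact hm k (by omega) hk') (by omega)
    have hlt : ∀ k < i, qrun K ρ (o :: os) m (BitVec.ofNat w k) = m (BitVec.ofNat w k) :=
      fun k hk => (key.1 k (by omega)).trans (hne k (by omega) (by omega))
    refine ⟨hlt, fun o' ho' => ?_⟩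
    rcases List.mem_cons.1 ho' with rfl | ho'
    · refine (key.1 o'.target (by omega)).trans ?_
      rw [QOp.act, Function.update_self, ht, hm i le_rfl hi', BitVec.zero_xor]
      exact o'.val_congr fun a haa => (hlt a (ha a haa)).symm
    · exact key.2 o' ho'

theorem SSA.spec_embed (hw : 6 ≤ w) {ops : List QOp} (h : SSA 1 ops) (x : BitVec w) :
    qrun K ρ ops (embed x) (BitVec.ofNat w 0) = x ∧
      ∀ o ∈ ops, qrun K ρ ops (embed x) (BitVec.ofNat w o.target) =
        o.val K ρ (qrun K ρ ops (embed x)) := by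
  have := h.spec (K := K) (ρ := ρ) hw (embed x) (fun k hk hk' =>
    embed_apply_of_ne x (ofNat_ne_ofNat hw hk' (by norm_num) (by omega))) (by norm_num)
  refine ⟨(this.1 0 one_pos).trans (embed_zero_apply x), this.2⟩

theorem execList_kick_emb (hw : 6 ≤ w) {ops : List QOp} (h : SSA 1 ops) {z : ℕ} (hz : z < 64)
    (σ : State w) (hσ : Addr σ.reg) {φ : BitVec w → ℂ} (hφ : σ.amp = emb φ) (f : BitVec w → Prop)
    [DecidablePred f]
    (hf : ∀ x, qrun K σ.reg ops (embed x) (BitVec.ofNat w z) = if f x then 1#w else 0#w) :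
    execList K (kick ops z) σ = ⟨σ.reg, emb fun x => (if f x then -1 else 1) * φ x⟩ := by
  rw [execList_kick hw h.wf hz σ hσ, hφ]
  congr 1
  funext m
  by_cases hm : m = embed (m 0#w)
  · rw [hm, emb_embed, emb_embed, hf]
    have h1 : (1#w).getLsbD 0 = true := by simp; omega
    by_cases hfm : f (m 0#w)
    · rw [if_pos hfm, if_pos hfm, if_pos h1]
    · rw [if_neg hfm, if_neg hfm]
      simp
  · simp only [emb, if_neg hm, mul_zero]

end

/-! ### The two predicates of the search -/

/-- Computes into the quantum word `2` whether the quantum word `0` vanishes. -/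
def zeroOps : List QOp := [.cst 100 1, .op .eq 0 1 2]

/-- Computes into the quantum word `29` whether the quantum word `0` encodes a violation of the axioms
of a metric. -/
def badOps : List QOp :=
  [.cst 8 1, .cst 6 2, .cst 0 3, .cst 100 4,
    .op .and 0 1 5, .op .shr 0 2 6, .op .and 6 1 7, .op .shr 6 2 8,
    .op .ult 5 3 9, .op .ult 7 3 10, .op .ult 8 3 11,
    .qry 5 7 12, .qry 7 5 13, .qry 5 8 14, .qry 8 7 15,
    .op .slt 12 4 16, .op .eq 12 4 17, .op .eq 5 7 18, .op .xor 17 18 19,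
    .op .eq 12 13 20, .op .eq 20 4 21, .op .add 14 15 22, .op .slt 22 12 23,
    .op .or 16 19 24, .op .or 24 21 25, .op .or 25 23 26,
    .op .and 9 10 27, .op .and 27 11 28, .op .and 26 28 29]

theorem zeroOps_ssa : SSA 1 zeroOps := by simp [zeroOps, SSA, QOp.target, QOp.args]

theorem badOps_ssa : SSA 1 badOps := by simp [badOps, SSA, QOp.target, QOp.args]

/-- The contents of the classical words that stay constant during the search. -/
structure Good {w : ℕ} (N h : ℕ) (ρ : ℕ → BitVec w) : Prop where
  addr : Addr ρ
  size : ρ 0 = BitVec.ofNat w N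
  shift : ρ 6 = BitVec.ofNat w (2 * h)
  bits : ρ 7 = BitVec.ofNat w (6 * h)
  mask : ρ 8 = BitVec.ofNat w (4 ^ h - 1)
  rounds : ρ 9 = BitVec.ofNat w (3 * h + 1)

/-- `i`, `j`, `k` violate the axioms of a metric. -/
def Violation {N : ℕ} (K : Matrix (Fin N) (Fin N) ℤ) (i j k : Fin N) : Prop :=
  ((K i j < 0 ∨ ¬ (K i j = 0 ↔ i = j)) ∨ ¬ K i j = K j i) ∨ K i k + K k j < K i j

/-- The word `x` encodes three indices that violate the axioms of a metric. -/
def Bad {N : ℕ} (K : Matrix (Fin N) (Fin N) ℤ) (h : ℕ) {w : ℕ} (x : BitVec w) : Prop :=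
  ∃ i j k : Fin N, i.1 = x.toNat % 4 ^ h ∧ j.1 = x.toNat / 4 ^ h % 4 ^ h ∧
    k.1 = x.toNat / 4 ^ h / 4 ^ h ∧ Violation K i j k

theorem ite_and_ite {w : ℕ} (P Q : Prop) [Decidable P] [Decidable Q] :
    ((if P then 1#w else 0#w) &&& if Q then 1#w else 0#w) = if P ∧ Q then 1#w else 0#w := by
  by_cases hP : P <;> by_cases hQ : Q <;> simp [hP, hQ]

theorem ite_or_ite {w : ℕ} (P Q : Prop) [Decidable P] [Decidable Q] :
    ((if P then 1#w else 0#w) ||| if Q then 1#w else 0#w) = if P ∨ Q then 1#w else 0#w := by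
  by_cases hP : P <;> by_cases hQ : Q <;> simp [hP, hQ]

theorem ite_xor_ite {w : ℕ} (P Q : Prop) [Decidable P] [Decidable Q] :
    ((if P then 1#w else 0#w) ^^^ if Q then 1#w else 0#w) =
      if ¬ (P ↔ Q) then 1#w else 0#w := by
  by_cases hP : P <;> by_cases hQ : Q <;> simp [hP, hQ]

theorem one_ne_zero_word {w : ℕ} (hw : 0 < w) : 1#w ≠ 0#w := by
  simp [BitVec.toNat_eq, hw.ne']

theorem ite_eq_zero_word {w : ℕ} (hw : 0 < w) (P : Prop) [Decidable P] :
    ((if P then 1#w else 0#w) = 0#w) ↔ ¬ P := by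
  have := one_ne_zero_word hw
  by_cases hP : P <;> simp [hP, this]

theorem toInt_ofInt_of_natAbs_lt {w : ℕ} (hw : 1 ≤ w) {a : ℤ} (ha : a.natAbs < 2 ^ (w - 1)) :
    (BitVec.ofInt w a).toInt = a := by
  obtain ⟨n, rfl⟩ : ∃ n, w = n + 1 := ⟨w - 1, by omega⟩
  simp only [Nat.add_sub_cancel] at ha
  rw [BitVec.toInt_ofInt]
  apply Int.bmod_eq_of_le_mul_two <;> push_cast [pow_succ] <;> zify at ha <;>
    rw [abs_lt] at ha <;> omega

section
variable {N : ℕ} {K : Matrix (Fin N) (Fin N) ℤ} {w : ℕ} {ρ : ℕ → BitVec w}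

theorem zeroOps_spec (hw : 6 ≤ w) (hρ : Addr ρ) (x : BitVec w) :
    qrun K ρ zeroOps (embed x) (BitVec.ofNat w 2) = if x = 0#w then 1#w else 0#w := by
  obtain ⟨h0, h⟩ := zeroOps_ssa.spec_embed (K := K) (ρ := ρ) hw x
  generalize qrun K ρ zeroOps (embed x) = F at h h0
  have h100 : ρ 100 = 0#w := hρ 0 (by norm_num)
  simp only [zeroOps, List.mem_cons, List.not_mem_nil, or_false, forall_eq_or_imp, forall_eq,
    QOp.target, QOp.val, WordOp.eval] at h
  rw [h.2, h.1, h0, h100]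

/-- The words `5`, `7`, `8` receive the indices `i`, `j`, `k`, and `9` to `11` their range checks;
`12` to `15` receive the entries `K i j`, `K j i`, `K i k`, `K k j`; `16`, `19`, `21`, `23` receive
the violations of the four axioms. -/
theorem badOps_spec (hw : 6 ≤ w) {h : ℕ} (hh : 6 * h ≤ w) (hN : N < 4 ^ h)
    (hK : ∀ i j, (K i j).natAbs < 2 ^ (w - 2)) (hρ : Good N h ρ) (x : BitVec w)
    [Decidable (Bad K h x)] :
    qrun K ρ badOps (embed x) (BitVec.ofNat w 29) = if Bad K h x then 1#w else 0#w := by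
  obtain ⟨h0, H⟩ := badOps_ssa.spec_embed (K := K) (ρ := ρ) hw x
  generalize qrun K ρ badOps (embed x) = F at H h0
  have h100 : ρ 100 = 0#w := hρ.addr 0 (by norm_num)
  simp only [badOps, List.mem_cons, List.not_mem_nil, or_false, forall_eq_or_imp, forall_eq,
    QOp.target, QOp.val, WordOp.eval] at H
  obtain ⟨h1, h2, h3, h4, h5, h6, h7, h8, h9, h10, h11, h12, h13, h14, h15, h16, h17, h18, h19,
    h20, h21, h22, h23, h24, h25, h26, h27, h28, h29⟩ := H
  have e4 : (4 : ℕ) ^ h = 2 ^ (2 * h) := by rw [pow_mul]; norm_num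
  have hlt : 2 * h < 2 ^ w :=
    lt_of_lt_of_le Nat.lt_two_pow_self (Nat.pow_le_pow_right two_pos (by omega))
  have h4w : (4 : ℕ) ^ h ≤ 2 ^ w := e4 ▸ Nat.pow_le_pow_right two_pos (by omega)
  have h4pos : 0 < (4 : ℕ) ^ h := by positivity
  have i5 : (F (BitVec.ofNat w 5)).toNat = x.toNat % 4 ^ h := by
    rw [h5, h0, h1, hρ.mask, BitVec.toNat_and, BitVec.toNat_ofNat, Nat.mod_eq_of_lt (by omega), e4,
      Nat.and_two_pow_sub_one_eq_mod]
  have i6 : (F (BitVec.ofNat w 6)).toNat = x.toNat / 4 ^ h := by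
    rw [h6, h0, h2, hρ.shift, BitVec.toNat_ushiftRight, BitVec.toNat_ofNat, Nat.mod_eq_of_lt hlt,
      e4, Nat.shiftRight_eq_div_pow]
  have i7 : (F (BitVec.ofNat w 7)).toNat = x.toNat / 4 ^ h % 4 ^ h := by
    rw [h7, h1, hρ.mask, BitVec.toNat_and, i6, BitVec.toNat_ofNat, Nat.mod_eq_of_lt (by omega), e4,
      Nat.and_two_pow_sub_one_eq_mod]
  have i8 : (F (BitVec.ofNat w 8)).toNat = x.toNat / 4 ^ h / 4 ^ h := by
    rw [h8, BitVec.toNat_ushiftRight, i6, h2, hρ.shift, BitVec.toNat_ofNat, Nat.mod_eq_of_lt hlt,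
      e4, Nat.shiftRight_eq_div_pow]
  have i3 : (F (BitVec.ofNat w 3)).toNat = N := by
    rw [h3, hρ.size, BitVec.toNat_ofNat, Nat.mod_eq_of_lt (by omega)]
  rw [h4, h100] at h16 h17 h21
  rw [h20] at h21
  simp only [BitVec.ult, decide_eq_true_eq, i5, i7, i8, i3] at h9 h10 h11
  rw [h29, h28, h27, h26, h25, h24, h23, h21, h19, h18, h17, h16, h11, h10, h9]
  simp only [ite_and_ite, ite_or_ite, ite_xor_ite, ite_eq_zero_word (show 0 < w by omega)]
  apply if_congr _ rfl rfl
  -- If an index is out of range, the range checks make both sides false, whatever the oracle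
  -- returns.
  by_cases hg : (x.toNat % 4 ^ h < N ∧ x.toNat / 4 ^ h % 4 ^ h < N) ∧ x.toNat / 4 ^ h / 4 ^ h < N
  · obtain ⟨⟨hi, hj⟩, hk⟩ := hg
    have hBad : Bad K h x ↔ Violation K ⟨_, hi⟩ ⟨_, hj⟩ ⟨_, hk⟩ := by
      constructor
      · rintro ⟨⟨i, hi'⟩, ⟨j, hj'⟩, ⟨k, hk'⟩, rfl, rfl, rfl, hv⟩
        exact hv
      · intro hv
        exact ⟨_, _, _, rfl, rfl, rfl, hv⟩
    rw [hBad]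
    simp only [hi, hj, hk, and_true]
    simp only [oracleWord, i5, i7, i8, hi, hj, hk, and_self, dif_pos] at h12 h13 h14 h15
    have h57 : F (BitVec.ofNat w 5) = F (BitVec.ofNat w 7) ↔
        (⟨_, hi⟩ : Fin N) = ⟨_, hj⟩ := by
      rw [BitVec.toNat_eq, i5, i7, Fin.mk.injEq]
    have hKs : ∀ i j, (K i j).natAbs < 2 ^ (w - 1) := fun i j =>
      (hK i j).trans_le (Nat.pow_le_pow_right two_pos (by omega))
    have hsum : F (BitVec.ofNat w 22) =
        BitVec.ofInt w (K ⟨_, hi⟩ ⟨_, hk⟩ + K ⟨_, hk⟩ ⟨_, hj⟩) := by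
      rw [h22, h14, h15, BitVec.ofInt_add]
    -- The spare bit in the bound on the entries keeps this sum from overflowing in two's
    -- complement.
    have hsumb : (K ⟨_, hi⟩ ⟨_, hk⟩ + K ⟨_, hk⟩ ⟨_, hj⟩).natAbs < 2 ^ (w - 1) := by
      have a1 := hK ⟨_, hi⟩ ⟨_, hk⟩
      have a2 := hK ⟨_, hk⟩ ⟨_, hj⟩
      have a3 : 2 ^ (w - 1) = 2 * 2 ^ (w - 2) := by
        rw [← pow_succ']; congr 1; omega
      omega
    have hw1 : 1 ≤ w := by omega
    rw [h57, hsum, h12, h13]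
    simp only [BitVec.slt, decide_eq_true_eq, BitVec.toInt_zero, ← BitVec.toInt_inj,
      toInt_ofInt_of_natAbs_lt hw1 (hKs _ _), toInt_ofInt_of_natAbs_lt hw1 hsumb]
    rfl
  · have : ¬ Bad K h x := by
      rintro ⟨i, j, k, hi, hj, hk, -⟩
      exact hg ⟨⟨hi ▸ i.2, hj ▸ j.2⟩, hk ▸ k.2⟩
    tauto

theorem exists_bad_iff {h : ℕ} (hh : 6 * h ≤ w) (hN : N < 4 ^ h) :
    (∃ x ∈ below w (6 * h), Bad K h x) ↔ ¬ DefinesMetric K := by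
  constructor
  · rintro ⟨x, -, i, j, k, -, -, -, hv⟩ hm
    rcases hv with ((hv | hv) | hv) | hv
    · exact hv.not_ge (hm.nonneg i j)
    · exact hv (hm.eq_zero_iff i j)
    · exact hv (hm.symm i j)
    · exact hv.not_ge (hm.triangle i j k)
  · intro hm
    have : ∃ i j k, Violation K i j k := by
      by_contra! H
      simp only [Violation, not_or, not_not, not_lt] at H
      -- Only the triangle inequality involves the third index; elsewhere `j` serves as a dummy.
      exact hm ⟨fun i j => (H i j j).1.1.1, fun i j => (H i j j).1.1.2, fun i j => (H i j j).1.2,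
        fun i j k => (H i j k).2⟩
    obtain ⟨i, j, k, hv⟩ := this
    have hi := i.2
    have hj := j.2
    have hk := k.2
    set B := 4 ^ h with hB
    -- The witness has the digits `i`, `j`, `k` in base `4 ^ h`.
    have hlt : i.1 + B * (j.1 + B * k.1) < 2 ^ (6 * h) := by
      have : 2 ^ (6 * h) = B * (B * B) := by
        rw [hB, ← pow_add, ← pow_add, show 6 * h = 2 * (h + (h + h)) by ring, pow_mul]
        norm_num
      rw [this]
      have h1 : j.1 + B * k.1 < B * B := by nlinarith
      nlinarith
    have hBpos : 0 < B := by omega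
    refine ⟨BitVec.ofNat w (i.1 + B * (j.1 + B * k.1)), ?_, i, j, k, ?_⟩
    · rw [mem_below, BitVec.toNat_ofNat]
      exact (Nat.mod_le _ _).trans_lt hlt
    · rw [BitVec.toNat_ofNat, Nat.mod_eq_of_lt (hlt.trans_le (Nat.pow_le_pow_right two_pos hh)),
        ← hB, Nat.add_mul_div_left _ _ hBpos, Nat.div_eq_of_lt (hi.trans hN), zero_add,
        Nat.add_mul_div_left _ _ hBpos, Nat.div_eq_of_lt (hj.trans hN), zero_add,
        Nat.add_mul_mod_self_left, Nat.add_mul_mod_self_left, Nat.mod_eq_of_lt (hi.trans hN),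
        Nat.mod_eq_of_lt (hj.trans hN)]
      exact ⟨rfl, rfl, rfl, hv⟩

/-- The lowest digit `4 ^ h - 1` is never a valid index, because `N < 4 ^ h`. Such a word guarantees
`cos θ ≠ 0`, so that dividing by `cos θ` is legitimate. -/
theorem exists_not_bad {h : ℕ} (hh : 6 * h ≤ w) (hN : N < 4 ^ h) :
    ∃ x ∈ below w (6 * h), ¬ Bad K h x := by
  have e4 : (4 : ℕ) ^ h = 2 ^ (2 * h) := by rw [pow_mul]; norm_num
  have h4w : (4 : ℕ) ^ h ≤ 2 ^ (6 * h) := e4 ▸ Nat.pow_le_pow_right two_pos (by omega)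
  have h6w : 2 ^ (6 * h) ≤ 2 ^ w := Nat.pow_le_pow_right two_pos hh
  have hx : (BitVec.ofNat w (4 ^ h - 1)).toNat = 4 ^ h - 1 := by
    rw [BitVec.toNat_ofNat, Nat.mod_eq_of_lt (by omega)]
  refine ⟨BitVec.ofNat w (4 ^ h - 1), ?_, ?_⟩
  · rw [mem_below, hx]
    omega
  · rintro ⟨i, j, k, hi, -⟩
    rw [hx, Nat.mod_eq_of_lt (by omega)] at hi
    have := i.2
    omega

end
end QRam
namespace QRam

/-! ### Amplitude amplification -/

/-- One step of the search: change the sign of the words in `f`, and reflect about the uniform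
superposition of the words below `2 ^ L`. -/
noncomputable def groverStep {w : ℕ} (f : BitVec w → Prop) [DecidablePred f] (L : ℕ)
    (φ : BitVec w → ℂ) : BitVec w → ℂ := fun x =>
  (if f x then -1 else 1) * φ x - 2 * (if x.toNat < 2 ^ L then
    (∑ y ∈ below w L, (if f y then -1 else 1) * φ y) / 2 ^ L else 0)

/-- The amplitudes after `j` steps of the search, where `θ` is the angle between the uniform
superposition and its projection to the words not in `f`. -/
noncomputable def searchAmp {w : ℕ} (f : BitVec w → Prop) [DecidablePred f] (L : ℕ) (θ : ℝ) (j : ℕ) :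
    BitVec w → ℂ := fun x =>
  if x.toNat < 2 ^ L then
    (((if f x then (-1) ^ j * Real.sin ((2 * j + 1) * θ) / (Real.sqrt 2 ^ L * Real.sin θ)
      else (-1) ^ j * Real.cos ((2 * j + 1) * θ) / (Real.sqrt 2 ^ L * Real.cos θ) : ℝ)) : ℂ)
  else 0

/-- `θ` is the angle between the uniform superposition of the words below `2 ^ L` and its projection
to the words not in `f`. -/
structure IsSearchAngle {w : ℕ} (f : BitVec w → Prop) [DecidablePred f] (L : ℕ) (θ : ℝ) : Prop where
  card_pos : (((below w L).filter f).card : ℝ) = 2 ^ L * Real.sin θ ^ 2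
  card_neg : (((below w L).filter (fun x => ¬ f x)).card : ℝ) = 2 ^ L * Real.cos θ ^ 2
  cos_ne_zero : Real.cos θ ≠ 0

section
variable {w : ℕ} {f : BitVec w → Prop} [DecidablePred f] {L : ℕ} {θ : ℝ}

theorem card_below (hL : L ≤ w) : (below w L).card = 2 ^ L := by
  have : (below w L).card = (Finset.range (2 ^ L)).card := by
    refine Finset.card_nbij' BitVec.toNat (BitVec.ofNat w) ?_ ?_ ?_ ?_
    · intro x hx
      exact Finset.mem_range.2 (mem_below.1 hx)
    · intro n hn
      refine mem_below.2 ?_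
      rw [BitVec.toNat_ofNat]
      exact (Nat.mod_le _ _).trans_lt (Finset.mem_range.1 hn)
    · intro x _
      simp
    · intro n hn
      rw [BitVec.toNat_ofNat, Nat.mod_eq_of_lt]
      exact (Finset.mem_range.1 hn).trans_le (Nat.pow_le_pow_right two_pos hL)
  rw [this, Finset.card_range]

/-- In `searchAmp`, the quotient by `sin θ` occurs only at words in `f`; one such word below `2 ^ L`
rules out a zero denominator. -/
theorem IsSearchAngle.sin_ne_zero (hθ : IsSearchAngle f L θ) {x : BitVec w} (hx : x ∈ below w L)
    (hf : f x) : Real.sin θ ≠ 0 := by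
  intro h
  have h1 := hθ.card_pos
  rw [h] at h1
  have h2 : ((below w L).filter f).card = 0 := by
    have : (((below w L).filter f).card : ℝ) = 0 := by rw [h1]; ring
    exact_mod_cast this
  rw [Finset.card_eq_zero, Finset.filter_eq_empty_iff] at h2
  exact h2 hx hf

theorem exists_isSearchAngle (hL : L ≤ w) (hf : ∃ x ∈ below w L, ¬ f x) :
    ∃ θ, IsSearchAngle f L θ ∧ 0 ≤ θ ∧ θ ≤ Real.pi / 2 := by
  have hD : (0 : ℝ) < 2 ^ L := by positivity
  have hsum := Finset.card_filter_add_card_filter_not (s := below w L) f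
  rw [card_below hL] at hsum
  have hsum' : (((below w L).filter f).card : ℝ) + ((below w L).filter (fun x => ¬ f x)).card =
      2 ^ L := by exact_mod_cast hsum
  have hpos : (0 : ℝ) < ((below w L).filter (fun x => ¬ f x)).card := by
    obtain ⟨x, hx, hfx⟩ := hf
    exact_mod_cast Finset.card_pos.2 ⟨x, Finset.mem_filter.2 ⟨hx, hfx⟩⟩
  set t : ℝ := (((below w L).filter f).card : ℝ) with htdef
  have ht : 0 ≤ t := Nat.cast_nonneg _
  have hq : t / 2 ^ L < 1 := by rw [div_lt_one hD]; linarith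
  have hq0 : 0 ≤ t / 2 ^ L := by positivity
  have hs : Real.sin (Real.arcsin (Real.sqrt (t / 2 ^ L))) = Real.sqrt (t / 2 ^ L) :=
    Real.sin_arcsin (by linarith [Real.sqrt_nonneg (t / 2 ^ L)]) (Real.sqrt_le_one.2 hq.le)
  have hs2 : Real.sin (Real.arcsin (Real.sqrt (t / 2 ^ L))) ^ 2 = t / 2 ^ L := by
    rw [hs, Real.sq_sqrt hq0]
  have hc2 : Real.cos (Real.arcsin (Real.sqrt (t / 2 ^ L))) ^ 2 = 1 - t / 2 ^ L := by
    rw [Real.cos_sq', hs2]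
  refine ⟨Real.arcsin (Real.sqrt (t / 2 ^ L)), ⟨?_, ?_, ?_⟩,
    Real.arcsin_nonneg.2 (Real.sqrt_nonneg _), Real.arcsin_le_pi_div_two _⟩
  · rw [hs2]; field_simp; rfl
  · rw [hc2]; field_simp; linarith
  · intro h
    rw [h] at hc2
    linarith

theorem sum_below_ite (a b : ℝ) :
    ∑ x ∈ below w L, (if f x then a else b) = ((below w L).filter f).card * a +
      ((below w L).filter (fun x => ¬ f x)).card * b := by
  rw [Finset.sum_ite]
  simp

theorem searchAmp_zero (hθ : IsSearchAngle f L θ) : searchAmp f L θ 0 = unif L := by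
  funext x
  have h2 : (Real.sqrt 2 : ℝ) ≠ 0 := (Real.sqrt_pos.2 two_pos).ne'
  simp only [searchAmp, unif]
  by_cases hx : x.toNat < 2 ^ L
  · rw [if_pos hx, if_pos hx]
    have hc := hθ.cos_ne_zero
    have key : (if f x then (-1) ^ 0 * Real.sin ((2 * (0 : ℕ) + 1) * θ) /
        (Real.sqrt 2 ^ L * Real.sin θ) else (-1) ^ 0 * Real.cos ((2 * (0 : ℕ) + 1) * θ) /
        (Real.sqrt 2 ^ L * Real.cos θ)) = 1 / Real.sqrt 2 ^ L := by
      split_ifs with hf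
      · have hs := hθ.sin_ne_zero (mem_below.2 hx) hf
        simp
        field_simp
      · simp
        field_simp
    rw [key]
    push_cast
    rfl
  · rw [if_neg hx, if_neg hx]

/-- Two reflections compose to a rotation by `2 * θ` in the plane of the marked and unmarked parts.
The alternating sign appears because the second reflection negates the uniform vector instead of
fixing it. -/
theorem groverStep_searchAmp (hθ : IsSearchAngle f L θ) (a : ℂ) (j : ℕ) :
    groverStep f L (fun x => a * searchAmp f L θ j x) =
      fun x => a * searchAmp f L θ (j + 1) x := by
  have h2 : (Real.sqrt 2 : ℝ) ≠ 0 := (Real.sqrt_pos.2 two_pos).ne'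
  have h22 : (2 : ℝ) ^ L = Real.sqrt 2 ^ L * Real.sqrt 2 ^ L := by
    rw [← mul_pow, Real.mul_self_sqrt two_pos.le]
  have hc := hθ.cos_ne_zero
  set A : ℝ := (-1) ^ j * Real.sin ((2 * j + 1) * θ) / (Real.sqrt 2 ^ L * Real.sin θ) with hA
  set B : ℝ := (-1) ^ j * Real.cos ((2 * j + 1) * θ) / (Real.sqrt 2 ^ L * Real.cos θ) with hB
  -- The overlap with the uniform vector after the sign flip is governed by `cos ((2 * j + 1) * θ +
  -- θ)`, via the addition formula.
  have hsum : ∑ y ∈ below w L, (if f y then (-1 : ℂ) else 1) * (a * searchAmp f L θ j y) =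
      a * (((-1) ^ j * Real.cos ((2 * j + 2) * θ) * Real.sqrt 2 ^ L : ℝ) : ℂ) := by
    have h1 : ∀ y ∈ below w L, (if f y then (-1 : ℂ) else 1) * (a * searchAmp f L θ j y) =
        a * ((if f y then -A else B : ℝ) : ℂ) := by
      intro y hy
      rw [mem_below] at hy
      simp only [searchAmp, if_pos hy]
      rw [← hA, ← hB]
      split_ifs
      · push_cast; ring
      · ring
    rw [Finset.sum_congr rfl h1, ← Finset.mul_sum, ← Complex.ofReal_sum, sum_below_ite,
      hθ.card_pos, hθ.card_neg]
    congr 2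
    have hcos : Real.cos ((2 * j + 2) * θ) = Real.cos ((2 * j + 1) * θ) * Real.cos θ -
        Real.sin ((2 * j + 1) * θ) * Real.sin θ := by
      rw [← Real.cos_add]; congr 1; ring
    rw [hcos, hA, hB, h22]
    -- Here `A` is a division by zero, but it is weighted by the number of marked words, which is
    -- zero.
    by_cases hs : Real.sin θ = 0
    · rw [hs]; field_simp; ring
    · field_simp; ring
  funext x
  simp only [groverStep]
  rw [hsum]
  by_cases hx : x.toNat < 2 ^ L
  · simp only [searchAmp, if_pos hx]
    have hj : ((j + 1 : ℕ) : ℝ) = j + 1 := by push_cast; ring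
    have h22' : (2 : ℂ) ^ L = ((Real.sqrt 2 ^ L * Real.sqrt 2 ^ L : ℝ) : ℂ) := by
      rw [← h22]; push_cast; rfl
    rw [h22', hj]
    by_cases hf : f x
    · have hs := hθ.sin_ne_zero (mem_below.2 hx) hf
      have h3 : Real.sin ((2 * (j + 1) + 1) * θ) = Real.sin ((2 * j + 1) * θ) +
          2 * Real.cos ((2 * j + 2) * θ) * Real.sin θ := by
        have e1 : (2 * ((j : ℝ) + 1) + 1) * θ = (2 * j + 2) * θ + θ := by ring
        have e2 : (2 * (j : ℝ) + 1) * θ = (2 * j + 2) * θ - θ := by ring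
        rw [e1, e2, Real.sin_add, Real.sin_sub]; ring
      have h4 : (-1) ^ (j + 1) * Real.sin ((2 * (j + 1) + 1) * θ) /
          (Real.sqrt 2 ^ L * Real.sin θ) = -A - 2 * ((-1) ^ j * Real.cos ((2 * j + 2) * θ) *
            Real.sqrt 2 ^ L / (Real.sqrt 2 ^ L * Real.sqrt 2 ^ L)) := by
        rw [h3, hA]; field_simp; ring
      simp only [if_pos hf]
      rw [h4, ← hA]
      push_cast
      ring
    · have h3 : Real.cos ((2 * (j + 1) + 1) * θ) =
          2 * Real.cos ((2 * j + 2) * θ) * Real.cos θ - Real.cos ((2 * j + 1) * θ) := by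
        have e1 : (2 * ((j : ℝ) + 1) + 1) * θ = (2 * j + 2) * θ + θ := by ring
        have e2 : (2 * (j : ℝ) + 1) * θ = (2 * j + 2) * θ - θ := by ring
        rw [e1, e2, Real.cos_add, Real.cos_sub]; ring
      have h4 : (-1) ^ (j + 1) * Real.cos ((2 * (j + 1) + 1) * θ) /
          (Real.sqrt 2 ^ L * Real.cos θ) = B - 2 * ((-1) ^ j * Real.cos ((2 * j + 2) * θ) *
            Real.sqrt 2 ^ L / (Real.sqrt 2 ^ L * Real.sqrt 2 ^ L)) := by
        rw [h3, hB]; field_simp; ring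
      simp only [if_neg hf]
      rw [h4, ← hB]
      push_cast
      ring
  · simp [searchAmp, if_neg hx]

theorem iterate_groverStep (hθ : IsSearchAngle f L θ) (a : ℂ) (j : ℕ) :
    (groverStep f L)^[j] (fun x => a * unif L x) = fun x => a * searchAmp f L θ j x := by
  induction j with
  | zero => rw [searchAmp_zero hθ]; rfl
  | succ j ih => rw [Function.iterate_succ_apply', ih, groverStep_searchAmp hθ]

/-- A measurement of the word after `j` steps finds a word in `f` with probability
`sin ((2 j + 1) θ) ^ 2`. -/
theorem sum_searchAmp (hθ : IsSearchAngle f L θ) (j : ℕ) (u v : ℝ) :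
    ∑ x : BitVec w, ‖searchAmp f L θ j x‖ ^ 2 * (if f x then u else v) =
      Real.sin ((2 * j + 1) * θ) ^ 2 * u + (1 - Real.sin ((2 * j + 1) * θ) ^ 2) * v := by
  have h2 : (Real.sqrt 2 : ℝ) ≠ 0 := (Real.sqrt_pos.2 two_pos).ne'
  have h22 : (2 : ℝ) ^ L = Real.sqrt 2 ^ L * Real.sqrt 2 ^ L := by
    rw [← mul_pow, Real.mul_self_sqrt two_pos.le]
  have hc := hθ.cos_ne_zero
  set A : ℝ := (-1) ^ j * Real.sin ((2 * j + 1) * θ) / (Real.sqrt 2 ^ L * Real.sin θ) with hA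
  set B : ℝ := (-1) ^ j * Real.cos ((2 * j + 1) * θ) / (Real.sqrt 2 ^ L * Real.cos θ) with hB
  have hj : ((-1 : ℝ) ^ j) ^ 2 = 1 := by rw [← pow_mul, mul_comm, pow_mul]; norm_num
  have h1 : ∀ x : BitVec w, x ∉ below w L →
      ‖searchAmp f L θ j x‖ ^ 2 * (if f x then u else v) = 0 := by
    intro x hx
    rw [mem_below] at hx
    simp [searchAmp, if_neg hx]
  rw [← Finset.sum_subset (Finset.subset_univ (below w L)) (fun x _ hx => h1 x hx)]
  have h3 : ∀ x ∈ below w L, ‖searchAmp f L θ j x‖ ^ 2 * (if f x then u else v) =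
      if f x then A ^ 2 * u else B ^ 2 * v := by
    intro x hx
    rw [mem_below] at hx
    simp only [searchAmp, if_pos hx, Complex.norm_real, Real.norm_eq_abs, sq_abs]
    split_ifs <;> rfl
  rw [Finset.sum_congr rfl h3, sum_below_ite, hθ.card_pos, hθ.card_neg, ← Real.cos_sq', hA, hB, h22]
  simp only [div_pow, mul_pow, hj, one_mul]
  by_cases hs : Real.sin θ = 0
  -- A multiple of `π` stays one after multiplication by `2 * j + 1`, so the vanishing marked term
  -- agrees with the formula.
  · obtain ⟨n, hn⟩ := Real.sin_eq_zero_iff.1 hs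
    have hs' : Real.sin ((2 * j + 1) * θ) = 0 := by
      rw [Real.sin_eq_zero_iff]
      exact ⟨(2 * j + 1) * n, by rw [← hn]; push_cast; ring⟩
    rw [hs, hs']
    field_simp
  · field_simp

/-- One of the numbers `2 ^ s - 1` of steps finds a word in `f` with probability at least one
half. -/
theorem exists_half_le_sin_sq {m : ℕ} (hθ : IsSearchAngle f (2 * m) θ) (h0 : 0 ≤ θ)
    (hpi : θ ≤ Real.pi / 2) (hf : ∃ x ∈ below w (2 * m), f x) :
    ∃ s ≤ m, 1 / 2 ≤ Real.sin ((2 * (2 ^ s - 1 : ℕ) + 1) * θ) ^ 2 := by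
  have hcast : ∀ s : ℕ, (2 * ((2 ^ s - 1 : ℕ) : ℝ) + 1) = 2 * 2 ^ s - 1 := by
    intro s
    rw [Nat.cast_sub Nat.one_le_two_pow]
    push_cast
    ring
  have hD : (0 : ℝ) < 2 ^ m := by positivity
  -- A single marked word among `2 ^ (2 * m)` already forces `sin θ ≥ 2 ^ (-m)`.
  have hθm : 1 ≤ 2 ^ m * θ := by
    have h1 : (1 : ℝ) ≤ 2 ^ (2 * m) * Real.sin θ ^ 2 := by
      rw [← hθ.card_pos]
      obtain ⟨x, hx, hfx⟩ := hf
      exact_mod_cast Finset.card_pos.2 ⟨x, Finset.mem_filter.2 ⟨hx, hfx⟩⟩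
    have h2 : 0 ≤ Real.sin θ := Real.sin_nonneg_of_nonneg_of_le_pi h0 (by linarith [Real.pi_pos])
    have h3 : Real.sin θ ≤ θ := Real.sin_le h0
    have h4 : (1 : ℝ) ≤ 2 ^ m * Real.sin θ := by
      have : (2 : ℝ) ^ (2 * m) * Real.sin θ ^ 2 = (2 ^ m * Real.sin θ) ^ 2 := by
        rw [mul_pow, ← pow_mul, mul_comm m 2]
      rw [this] at h1
      have h5 : 0 ≤ 2 ^ m * Real.sin θ := by positivity
      nlinarith
    nlinarith
  have hex : ∃ s : ℕ, Real.pi / 4 < (2 * 2 ^ s - 1) * θ := by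
    refine ⟨m, ?_⟩
    have : (1 : ℝ) ≤ 2 ^ m := one_le_pow₀ (by norm_num)
    nlinarith [Real.pi_lt_four]
  classical
  have hm : Real.pi / 4 < (2 * 2 ^ m - 1) * θ := by
    have : (1 : ℝ) ≤ 2 ^ m := one_le_pow₀ (by norm_num)
    nlinarith [Real.pi_lt_four]
  -- Take the first `s` whose angle exceeds `π / 4`; `s = m` qualifies, since `(2 * 2 ^ m - 1) * θ ≥
  -- 2 ^ m * θ ≥ 1 > π / 4`.
  refine ⟨Nat.find hex, Nat.find_min' hex hm, ?_⟩
  rw [hcast]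
  have hlow := Nat.find_spec hex
  -- The previous angle is at most `π / 4`, and `2 * 2 ^ (s + 1) - 1 ≤ 3 * (2 * 2 ^ s - 1)`. For `s
  -- = 0` the angle is `θ ≤ π / 2`.
  have hup : (2 * 2 ^ Nat.find hex - 1) * θ ≤ 3 * (Real.pi / 4) := by
    rcases hs : Nat.find hex with _ | s
    · norm_num
      linarith [Real.pi_pos]
    · have h1 := Nat.find_min hex (m := s) (by omega)
      rw [not_lt] at h1
      have : (1 : ℝ) ≤ 2 ^ s := one_le_pow₀ (by norm_num)
      rw [pow_succ]
      nlinarith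
  set y := (2 * 2 ^ Nat.find hex - 1) * θ
  have hcos : Real.cos (2 * y) ≤ 0 :=
    Real.cos_nonpos_of_pi_div_two_le_of_le (by linarith) (by linarith [Real.pi_pos])
  rw [Real.cos_two_mul, Real.cos_sq'] at hcos
  linarith

end
end QRam
namespace QRam

/-! ### The search program -/

/-- Hadamard gates on the qubits `0, …, c[7] - 1` of the quantum word `0`. -/
def upProg : Prog :=
  block [.const 11 0, .arith .add 7 100 12]
    (.loop 12 (block [.hadamard 100 11, .arith .add 11 101 11] (.instr (.arith .sub 12 101 12))))

/-- Hadamard gates on the qubits `c[7] - 1, …, 0` of the quantum word `0`. -/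
def downProg : Prog :=
  block [.arith .add 7 100 11]
    (.loop 11 (block [.arith .sub 11 101 11] (.instr (.hadamard 100 11))))

/-- A Grover iteration: phase oracle, then the sign flip at zero between two layers of Hadamard
gates. -/
def stepProg : Prog :=
  block (kick badOps 29) (.seq downProg (block (kick zeroOps 2) upProg))

/-- `c[14]` steps of the search, starting with the uniform superposition. -/
def searchProg : Prog :=
  .seq upProg (block [.arith .add 14 100 13]
    (.loop 13 (.seq stepProg (.instr (.arith .sub 13 101 13)))))

/-- Xoring the measured outcome back into quantum word `0` clears it. The flag `c[17]` accumulates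
the predicate outcomes, and `c[14]` goes from `2 ^ s - 1` to `2 * (2 ^ s - 1) + 1 = 2 ^ (s + 1) -
1`. -/
def finishRound : List Instr :=
  [.qconst 19 100, .arith .or 17 18 17, .arith .add 14 14 14, .arith .add 14 101 14]

/-- Measure whether the quantum word `0` encodes a violation, and reset it by measuring it, too. -/
def readProg : Prog :=
  block (badOps.map QOp.toInstr) (.seq (.measure 18 129)
    (block (badOps.reverse.map QOp.toInstr) (.seq (.measure 19 100)
      (block finishRound (.instr (.arith .sub 15 101 15))))))

def roundProg : Prog := .seq searchProg readProg

/-- Rounds of the search with `0, 1, 3, …, 2 ^ (c[9] - 1) - 1` steps. -/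
def sweepProg : Prog := block [.const 14 0, .arith .add 9 100 15] (.loop 15 roundProg)

def outerProg : Prog := .loop 16 (.seq sweepProg (.instr (.arith .sub 16 101 16)))

def setAddrs : List Instr := (List.range 64).map fun k => .const (100 + k) k

/-- Count the digits of `c[0]` in base `4`. -/
def digitsProg : Prog :=
  .loop 20 (block [.arith .shr 20 102 20] (.instr (.arith .add 5 101 5)))

/-- From `c[5] = h` and `c[10] = d`: bits per index, bits per triple, index mask, rounds per sweep,
and the number `2 * h * d` of sweeps. -/
def setSizes : List Instr :=
  [.arith .mul 102 5 6, .arith .mul 106 5 7, .arith .shl 101 6 8, .arith .sub 8 101 8,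
    .arith .mul 103 5 9, .arith .add 9 101 9, .arith .mul 10 6 16]

def metricProg (d : ℕ) : Prog :=
  block setAddrs (block [.const 10 d, .const 5 0, .arith .add 0 100 20]
    (.seq digitsProg (block setSizes (.seq outerProg (.instr (.arith .eq 17 100 0))))))

def upTime (h : ℕ) : ℕ := 6 * h * 6 + 1 + 4
def downTime (h : ℕ) : ℕ := 6 * h * 4 + 1 + 2
def stepTime (h : ℕ) : ℕ :=
  downTime h + (upTime h + 2 * (kick zeroOps 2).length) + 1 + 2 * (kick badOps 29).length
def searchTime (h j : ℕ) : ℕ := upTime h + (j * (stepTime h + 1 + 1 + 1) + 1 + 2) + 1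

section
variable {N : ℕ} {K : Matrix (Fin N) (Fin N) ℤ} {w : ℕ}

theorem ofNat_ne_zero {a : ℕ} (h0 : a ≠ 0) (ha : a < 2 ^ w) : BitVec.ofNat w a ≠ 0#w := by
  intro h
  have := congrArg BitVec.toNat h
  rw [BitVec.toNat_ofNat, Nat.mod_eq_of_lt ha] at this
  simp at this
  exact h0 this

theorem ofNat_sub_one {a : ℕ} (h0 : a ≠ 0) :
    BitVec.ofNat w a - BitVec.ofNat w 1 = BitVec.ofNat w (a - 1) := by
  obtain ⟨n, rfl⟩ := Nat.exists_eq_succ_of_ne_zero h0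
  rw [Nat.succ_eq_add_one, BitVec.ofNat_add, BitVec.add_sub_cancel, Nat.add_sub_cancel]

/-- The classical words `11` to `20` are the work area of the search; constants and addresses lie
outside it. -/
theorem Addr.eqOff {ρ ρ' : ℕ → BitVec w} (h : Addr ρ) {s : Finset ℕ} (hs : EqOff s ρ ρ')
    (hss : s ⊆ Finset.Icc 11 20) : Addr ρ' := by
  intro k hk
  rw [hs _ (fun h' => by have := Finset.mem_Icc.1 (hss h'); omega), h k hk]

theorem Good.eqOff {h : ℕ} {ρ ρ' : ℕ → BitVec w} (hρ : Good N h ρ) {s : Finset ℕ}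
    (hs : EqOff s ρ ρ') (hss : s ⊆ Finset.Icc 11 20) : Good N h ρ' := by
  have key : ∀ r < 11, ρ' r = ρ r := fun r hr =>
    hs r (fun h' => by have := Finset.mem_Icc.1 (hss h'); omega)
  refine ⟨hρ.addr.eqOff hs hss, ?_, ?_, ?_, ?_, ?_⟩
  · rw [key 0 (by norm_num), hρ.size]
  · rw [key 6 (by norm_num), hρ.shift]
  · rw [key 7 (by norm_num), hρ.bits]
  · rw [key 8 (by norm_num), hρ.mask]
  · rw [key 9 (by norm_num), hρ.rounds]

theorem lt_two_pow_of_le {a : ℕ} (h : a ≤ w) : a < 2 ^ w :=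
  Nat.lt_two_pow_self.trans_le (Nat.pow_le_pow_right two_pos h)

theorem exec_upProg {h : ℕ} (hh : 6 * h ≤ w) (σ : State w) (hσ : Good N h σ.reg)
    {φ : BitVec w → ℂ} (hφ : σ.amp = emb φ) :
    ∃ σ', Exec K upProg (upTime h) σ σ' ∧ EqOff {11, 12} σ.reg σ'.reg ∧
      σ'.amp = emb (up (6 * h) φ) := by
  have h100 : σ.reg 100 = 0#w := hσ.addr 0 (by norm_num)
  have h101 : σ.reg 101 = BitVec.ofNat w 1 := hσ.addr 1 (by norm_num)
  let I : ℕ → State w → Prop := fun i τ => EqOff {11, 12} σ.reg τ.reg ∧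
    τ.reg 11 = BitVec.ofNat w i ∧ τ.reg 12 = BitVec.ofNat w (6 * h - i) ∧ τ.amp = emb (up i φ)
  have hstep : ∀ i < 6 * h, ∀ τ, I i τ → τ.reg 12 ≠ 0#w ∧ ∃ τ', Exec K
      (block [.hadamard 100 11, .arith .add 11 101 11] (.instr (.arith .sub 12 101 12))) (1 + 2 * 2) τ τ' ∧ I (i + 1) τ' := by
    rintro i hi τ ⟨hτ, hb, hc, ha⟩
    have t100 : τ.reg 100 = 0#w := (hτ 100 (by decide)).trans h100
    have t101 : τ.reg 101 = BitVec.ofNat w 1 := (hτ 101 (by decide)).trans h101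
    refine ⟨hc ▸ ofNat_ne_zero (by omega) (lt_two_pow_of_le (by omega)), _,
      exec_block_instr _ _ _, ?_⟩
    simp only [execList, List.foldl, Instr.exec, I]
    refine ⟨(hτ.update (by decide) _).update (by decide) _, ?_, ?_, ?_⟩
    · simp [WordOp.eval, hb, t101, BitVec.ofNat_add]
    · simp only [Function.update_self, WordOp.eval]
      rw [Function.update_of_ne (by decide), Function.update_of_ne (by decide), hc, t101,
        ofNat_sub_one (by omega)]
      congr 1
    · rw [ha, t100, hb, BitVec.toNat_ofNat, Nat.mod_eq_of_lt (lt_two_pow_of_le (by omega)),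
        hadamardGate_emb (by omega)]
      rfl
  have hend : ∀ τ, I (6 * h) τ → τ.reg 12 = 0#w := by
    rintro τ ⟨-, -, hc, -⟩
    simpa using hc
  have hstart : I 0 (execList K [.const 11 0, .arith .add 7 100 12] σ) := by
    simp only [execList, List.foldl, Instr.exec, I]
    refine ⟨((EqOff.refl _ _).update (by decide) _).update (by decide) _, ?_, ?_, hφ⟩
    · simp
    · simp [WordOp.eval, hσ.bits, h100]
  obtain ⟨σ', he, h1, -, -, h4⟩ := exec_loop I (6 * h) _ hstep hend _ hstart
  exact ⟨σ', he.block, h1, h4⟩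

theorem exec_downProg {h : ℕ} (hh : 6 * h ≤ w) (σ : State w) (hσ : Good N h σ.reg)
    {φ : BitVec w → ℂ} (hφ : σ.amp = emb φ) :
    ∃ σ', Exec K downProg (downTime h) σ σ' ∧ EqOff {11, 12} σ.reg σ'.reg ∧
      σ'.amp = emb (down (6 * h) φ) := by
  have h100 : σ.reg 100 = 0#w := hσ.addr 0 (by norm_num)
  have h101 : σ.reg 101 = BitVec.ofNat w 1 := hσ.addr 1 (by norm_num)
  -- Since `down` applies its first gate innermost, the invariant records what the remaining gates
  -- will produce, not what has been done.
  let I : ℕ → State w → Prop := fun i τ => EqOff {11, 12} σ.reg τ.reg ∧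
    τ.reg 11 = BitVec.ofNat w (6 * h - i) ∧
      ∃ χ, τ.amp = emb χ ∧ down (6 * h - i) χ = down (6 * h) φ
  have hstep : ∀ i < 6 * h, ∀ τ, I i τ → τ.reg 11 ≠ 0#w ∧ ∃ τ', Exec K
      (block [.arith .sub 11 101 11] (.instr (.hadamard 100 11))) (1 + 2 * 1) τ τ' ∧ I (i + 1) τ' := by
    rintro i hi τ ⟨hτ, hb, χ, ha, hχ⟩
    have t100 : τ.reg 100 = 0#w := (hτ 100 (by decide)).trans h100
    have t101 : τ.reg 101 = BitVec.ofNat w 1 := (hτ 101 (by decide)).trans h101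
    refine ⟨hb ▸ ofNat_ne_zero (by omega) (lt_two_pow_of_le (by omega)), _,
      exec_block_instr _ _ _, ?_⟩
    simp only [execList, List.foldl, Instr.exec, I]
    refine ⟨hτ.update (by decide) _, ?_, had (6 * h - (i + 1)) χ, ?_, ?_⟩
    · simp only [Function.update_self, WordOp.eval]
      rw [hb, t101, ofNat_sub_one (by omega)]
      congr 1
    · simp only [Function.update_self, WordOp.eval]
      rw [Function.update_of_ne (by decide), t100, hb, t101, ofNat_sub_one (by omega),
        BitVec.toNat_ofNat, Nat.mod_eq_of_lt (lt_two_pow_of_le (by omega)), ha,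
        hadamardGate_emb (by omega)]
      congr 1
    · rw [← hχ, show 6 * h - i = (6 * h - (i + 1)) + 1 by omega]
      rfl
  have hend : ∀ τ, I (6 * h) τ → τ.reg 11 = 0#w := by
    rintro τ ⟨-, hc, -⟩
    simpa using hc
  have hstart : I 0 (execList K [.arith .add 7 100 11] σ) := by
    simp only [execList, List.foldl, Instr.exec, I]
    refine ⟨(EqOff.refl _ _).update (by decide) _, ?_, φ, hφ, rfl⟩
    simp [WordOp.eval, hσ.bits, h100]
  obtain ⟨σ', he, h1, -, χ, h4, h5⟩ := exec_loop I (6 * h) _ hstep hend _ hstart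
  refine ⟨σ', he.block, h1, ?_⟩
  rw [h4, ← h5, Nat.sub_self]
  rfl

/-- The bounds on the word length that the program needs. -/
structure Fits (K : Matrix (Fin N) (Fin N) ℤ) (w h : ℕ) : Prop where
  six_le : 6 ≤ w
  bits_le : 6 * h ≤ w
  size_lt : N < 4 ^ h
  natAbs_lt : ∀ i j, (K i j).natAbs < 2 ^ (w - 2)

open Classical in
theorem exec_stepProg {h : ℕ} (hK : Fits K w h) (σ : State w) (hσ : Good N h σ.reg)
    {φ : BitVec w → ℂ} (hφ : σ.amp = emb φ) :
    ∃ σ', Exec K stepProg (stepTime h) σ σ' ∧ EqOff {11, 12} σ.reg σ'.reg ∧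
      σ'.amp = emb (groverStep (Bad K h) (6 * h) φ) := by
  have e1 := execList_kick_emb hK.six_le badOps_ssa (z := 29) (by norm_num) σ hσ.addr hφ (Bad K h)
    (fun x => badOps_spec hK.six_le hK.bits_le hK.size_lt hK.natAbs_lt hσ x)
  obtain ⟨σ₂, he2, hr2, ha2⟩ := exec_downProg (K := K) hK.bits_le (execList K (kick badOps 29) σ)
    (by rw [e1]; exact hσ) (by rw [e1])
  rw [e1] at hr2
  have hσ₂ : Good N h σ₂.reg := hσ.eqOff hr2 (by decide)
  have e3 := execList_kick_emb (K := K) hK.six_le zeroOps_ssa (z := 2) (by norm_num) σ₂ hσ₂.addr ha2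
    (fun x => x = 0#w) (fun x => zeroOps_spec hK.six_le hσ₂.addr x)
  obtain ⟨σ₄, he4, hr4, ha4⟩ := exec_upProg (K := K) hK.bits_le (execList K (kick zeroOps 2) σ₂)
    (by rw [e3]; exact hσ₂) (by rw [e3])
  rw [e3] at hr4
  refine ⟨σ₄, (he2.seq he4.block).block, hr2.trans hr4, ?_⟩
  rw [ha4, up_flip_down hK.bits_le]
  rfl

open Classical in
theorem exec_searchProg {h j : ℕ} (hK : Fits K w h) (hj : j < 2 ^ w) (σ : State w)
    (hσ : Good N h σ.reg) (h14 : σ.reg 14 = BitVec.ofNat w j) {a : ℂ}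
    (hφ : σ.amp = emb fun x => a * if x = 0#w then 1 else 0) :
    ∃ σ', Exec K searchProg (searchTime h j) σ σ' ∧ EqOff {11, 12, 13} σ.reg σ'.reg ∧
      σ'.amp = emb ((groverStep (Bad K h) (6 * h))^[j] fun x => a * unif (6 * h) x) := by
  obtain ⟨σ₁, he1, hr1, ha1⟩ := exec_upProg (K := K) hK.bits_le σ hσ hφ
  have ha1' : σ₁.amp = emb fun x => a * unif (6 * h) x := by
    -- Homogeneity of `up` is extracted from its compatibility with differences, by subtracting `-a`
    -- times the basis state from zero.
    have := up_sub_smul (w := w) (6 * h) (fun _ => 0) (fun x => if x = 0#w then 1 else 0) (-a)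
    have h0 : up (6 * h) (fun _ : BitVec w => (0 : ℂ)) = fun _ => 0 := by
      have := up_sub_smul (w := w) (6 * h) (fun _ => 0) (fun _ => 0) 1
      funext x
      have := congrFun this x
      simpa using this
    rw [h0, up_delta hK.bits_le] at this
    have e : (fun x : BitVec w => a * if x = 0#w then (1 : ℂ) else 0) =
        fun x => 0 - -a * if x = 0#w then 1 else 0 := by
      funext x
      ring
    rw [ha1, e, this]
    congr 1
    funext x
    ring
  have hσ₁ : Good N h σ₁.reg := hσ.eqOff hr1 (by decide)
  have h100 : σ₁.reg 100 = 0#w := hσ₁.addr 0 (by norm_num)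
  have h14' : σ₁.reg 14 = BitVec.ofNat w j := (hr1 14 (by decide)).trans h14
  let I : ℕ → State w → Prop := fun i τ => EqOff {11, 12, 13} σ.reg τ.reg ∧
    τ.reg 13 = BitVec.ofNat w (j - i) ∧
      τ.amp = emb ((groverStep (Bad K h) (6 * h))^[i] fun x => a * unif (6 * h) x)
  have hstep : ∀ i < j, ∀ τ, I i τ → τ.reg 13 ≠ 0#w ∧ ∃ τ', Exec K
      (.seq stepProg (.instr (.arith .sub 13 101 13))) (stepTime h + 1 + 1) τ τ' ∧ I (i + 1) τ' := by
    rintro i hi τ ⟨hτ, hb, ha⟩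
    have hτg : Good N h τ.reg := hσ.eqOff hτ (by decide)
    obtain ⟨τ', he, hr, ha'⟩ := exec_stepProg hK τ hτg ha
    have t101 : τ'.reg 101 = BitVec.ofNat w 1 := (hτg.eqOff hr (by decide)).addr 1 (by norm_num)
    have t13 : τ'.reg 13 = BitVec.ofNat w (j - i) := (hr 13 (by decide)).trans hb
    refine ⟨hb ▸ ofNat_ne_zero (by omega) (by omega), _, he.seq (exec_instr _ _), ?_⟩
    simp only [Instr.exec, I]
    refine ⟨(hτ.trans (hr.mono (by decide))).update (by decide) _, ?_, ?_⟩
    · simp only [Function.update_self, WordOp.eval]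
      rw [t13, t101, ofNat_sub_one (by omega)]
      congr 1
    · rw [ha', Function.iterate_succ_apply']
  have hend : ∀ τ, I (j) τ → τ.reg 13 = 0#w := by
    rintro τ ⟨-, hc, -⟩
    simpa using hc
  have hstart : I 0 (execList K [.arith .add 14 100 13] σ₁) := by
    simp only [execList, List.foldl, Instr.exec, I]
    refine ⟨(hr1.mono (by decide)).update (by decide) _, ?_, ha1'⟩
    simp [WordOp.eval, h14', h100]
  obtain ⟨σ', he, h1, -, h4⟩ := exec_loop I (j) _ hstep hend _ hstart
  exact ⟨σ', he1.seq he.block, h1, h4⟩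

end
end QRam
namespace QRam

/-! ### The probabilities of the outcomes -/

def readTime : ℕ :=
  1 + 2 * finishRound.length + 1 + 1 + 2 * (badOps.reverse.map QOp.toInstr).length + 1 + 1 +
    2 * (badOps.map QOp.toInstr).length

/-- The state after `readProg`, if the outcomes of the measurements are `f` and `v`. -/
noncomputable def readState {N : ℕ} (K : Matrix (Fin N) (Fin N) ℤ) {w : ℕ} (σ : State w)
    (f v : BitVec w) : State w :=
  (Instr.arith .sub 15 101 15).exec K (execList K finishRound
    ((execList K (badOps.reverse.map QOp.toInstr)
      ((execList K (badOps.map QOp.toInstr) σ).measured 18 129 f)).measured 19 100 v))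

/-- The probability of the output `out`, if a violation has been found (`b = true`), or if none has
been found and the remaining rounds find none with probability `q`. -/
def outcome (out b : Bool) (q : ℝ) : ℝ :=
  match out, b with
  | true, true => 0
  | false, true => 1
  | true, false => q
  | false, false => 1 - q

/-- Between two rounds of the search: nothing has been found if and only if `b = false`, and the
quantum memory is in the basis state zero, with amplitude `a`. -/
structure Ready {w : ℕ} (N h : ℕ) (b : Bool) (a : ℂ) (σ : State w) : Prop where
  good : Good N h σ.reg
  found : σ.reg 17 ≠ 0#w ↔ b = true
  amp : σ.amp = emb fun x => a * if x = 0#w then 1 else 0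

/-- From each state between two rounds with `P`, the programs `l` find no violation within `t` units of
time with probability `q`. -/
def HasVal {N : ℕ} (K : Matrix (Fin N) (Fin N) ℤ) {w : ℕ} (h : ℕ) (P : (ℕ → BitVec w) → Prop) (t : ℕ)
    (l : List Prog) (q : ℝ) : Prop :=
  ∀ (σ : State w) (b : Bool) (a : ℂ), Ready N h b a σ → P σ.reg →
    ∀ out, outProb K out t l σ = ‖a‖ ^ 2 * outcome out b q

def roundTime (h j : ℕ) : ℕ := searchTime h j + readTime + 1

/-- The values of the counters `c[14]`, `c[15]`, `c[16]`. -/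
def Counters (w it sc rc : ℕ) (ρ : ℕ → BitVec w) : Prop :=
  ρ 14 = BitVec.ofNat w it ∧ ρ 15 = BitVec.ofNat w sc ∧ ρ 16 = BitVec.ofNat w rc

/-- The time of the rounds `s, …, s + r - 1` of a sweep. -/
def loopTime (h : ℕ) : ℕ → ℕ → ℕ
  | _, 0 => 1
  | s, r + 1 => loopTime h (s + 1) r + roundTime h (2 ^ s - 1) + 1

def sweepTime (h : ℕ) : ℕ := loopTime h 0 (3 * h + 1) + 2 * 2

/-- The probability that a search with `j` steps fails. -/
noncomputable def failProb (θ : ℝ) (j : ℕ) : ℝ := 1 - Real.sin ((2 * j + 1) * θ) ^ 2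

section
variable {N : ℕ} {K : Matrix (Fin N) (Fin N) ℤ} {w : ℕ}

theorem outProb_readProg (out : Bool) (t : ℕ) (l : List Prog) (σ : State w) :
    outProb K out (t + readTime) (readProg :: l) σ =
      ∑ f, ∑ v, outProb K out t l (readState K σ f v) := by
  simp only [readTime, ← add_assoc]
  rw [readProg, outProb_block, outProb, outProb]
  refine Finset.sum_congr rfl fun f _ => ?_
  rw [outProb_block, outProb, outProb]
  refine Finset.sum_congr rfl fun v _ => ?_
  rw [outProb_block, outProb]
  rfl

theorem qrun_congr {ρ ρ' : ℕ → BitVec w} {ops : List QOp}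
    (h : ∀ o ∈ ops, ∀ m, o.val K ρ m = o.val K ρ' m) (m : Basis w) :
    qrun K ρ ops m = qrun K ρ' ops m := by
  induction ops generalizing m with
  | nil => rfl
  | cons o os ih =>
    change qrun K ρ os (o.act K ρ m) = qrun K ρ' os (o.act K ρ' m)
    rw [ih (fun o ho => h o (List.mem_cons_of_mem _ ho)), QOp.act, QOp.act,
      h o List.mem_cons_self]

/-- Uncomputing happens after a measurement has altered the classical memory; it still inverts the
computation, as only protected constants are read. -/
theorem qrun_badOps_congr {h : ℕ} {ρ ρ' : ℕ → BitVec w} (hρ : Good N h ρ) (hρ' : Good N h ρ')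
    (m : Basis w) : qrun K ρ badOps m = qrun K ρ' badOps m := by
  have e1 := hρ.addr 0 (by norm_num)
  have e2 := hρ'.addr 0 (by norm_num)
  refine qrun_congr ?_ m
  simp only [badOps, List.mem_cons, List.not_mem_nil, or_false, forall_eq_or_imp, forall_eq,
    QOp.val, implies_true, and_true]
  rw [hρ.mask, hρ.shift, hρ.size, hρ'.mask, hρ'.shift, hρ'.size, e1, e2]
  simp

-- Measuring the predicate word keeps exactly the inputs whose predicate value is `f`, so
-- uncomputing still clears the scratch words. Measuring word `0` as `v` and xoring `v` back leaves
-- the zero state, with the amplitude of `v` if `f` is the predicate value of `v`, and `0`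
-- otherwise.
open Classical in
theorem readState_spec {h : ℕ} (hK : Fits K w h) (σ : State w) (hσ : Good N h σ.reg)
    {φ : BitVec w → ℂ} (hφ : σ.amp = emb φ) (f v : BitVec w) :
    EqOff {14, 15, 17, 18, 19} σ.reg (readState K σ f v).reg ∧
      (readState K σ f v).reg 14 = σ.reg 14 + σ.reg 14 + 1#w ∧
      (readState K σ f v).reg 15 = σ.reg 15 - 1#w ∧
      (readState K σ f v).reg 17 = σ.reg 17 ||| f ∧
      (readState K σ f v).amp = emb fun x =>
        (if (if Bad K h v then 1#w else 0#w) = f then φ v else 0) * if x = 0#w then 1 else 0 := by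
  have h100 : σ.reg 100 = 0#w := hσ.addr 0 (by norm_num)
  have h101 : σ.reg 101 = 1#w := hσ.addr 1 (by norm_num)
  have h129 : σ.reg 129 = BitVec.ofNat w 29 := hσ.addr 29 (by norm_num)
  have hwf := badOps_ssa.wf
  have hwf' : ∀ o ∈ badOps.reverse, o.WF := fun o ho => hwf o (List.mem_reverse.1 ho)
  have hgood : Good N h (Function.update σ.reg 18 f) :=
    hσ.eqOff ((EqOff.refl {18} σ.reg).update (by decide) f) (by decide)
  have e1 : (execList K (badOps.map QOp.toInstr) σ).measured 18 129 f =
      ⟨Function.update σ.reg 18 f, fun m => if m (BitVec.ofNat w 29) = f then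
        σ.amp (qrun K σ.reg badOps.reverse m) else 0⟩ := by
    rw [execList_qops hK.six_le hwf σ hσ.addr]
    simp only [State.measured, h129]
  have e2 : execList K (badOps.reverse.map QOp.toInstr)
      ((execList K (badOps.map QOp.toInstr) σ).measured 18 129 f) =
      ⟨Function.update σ.reg 18 f,
        emb fun x => if (if Bad K h x then 1#w else 0#w) = f then φ x else 0⟩ := by
    rw [e1, execList_qops hK.six_le hwf' _ (by exact hgood.addr)]
    congr 1
    funext m
    simp only [List.reverse_reverse]
    rw [qrun_badOps_congr hgood hσ, qrun_reverse_qrun hK.six_le hwf, hφ]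
    by_cases hm : m = embed (m 0#w)
    · rw [hm, emb_embed, emb_embed,
        badOps_spec hK.six_le hK.bits_le hK.size_lt hK.natAbs_lt hσ]
    · simp only [emb, if_neg hm, ite_self]
  rw [readState, e2]
  simp only [State.measured, finishRound, execList, List.foldl, Instr.exec]
  refine ⟨?_, ?_, ?_, ?_, ?_⟩
  · refine EqOff.update (EqOff.update (EqOff.update (EqOff.update (EqOff.update (EqOff.update
      (EqOff.refl _ _) ?_ _) ?_ _) ?_ _) ?_ _) ?_ _) ?_ _ <;> decide
  · simp [WordOp.eval, h101]
  · simp [WordOp.eval, h101]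
  · simp [WordOp.eval]
  · have hm : (fun m : Basis w => if m (Function.update σ.reg 18 f 100) = v then
        emb (fun x => if (if Bad K h x then 1#w else 0#w) = f then φ x else 0) m else 0) =
        emb fun x => if x = v then
          (if (if Bad K h x then 1#w else 0#w) = f then φ x else 0) else 0 := by
      funext m
      have : Function.update σ.reg 18 f 100 = 0#w := by simp [h100]
      rw [this]
      simp only [emb]
      split_ifs <;> rfl
    rw [hm]
    have hz : Function.update (Function.update σ.reg 18 f) 19 v 100 = 0#w := by simp [h100]
    rw [hz, Function.update_self, xorInto_emb]
    congr 1
    funext x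
    have hx : x ^^^ v = v ↔ x = 0#w := by
      constructor
      · intro hx
        have := congrArg (· ^^^ v) hx
        simpa [BitVec.xor_assoc] using this
      · rintro rfl
        simp
    by_cases hx0 : x = 0#w
    · simp [hx0]
    · simp [hx0, hx]

theorem outcome_mix (out b : Bool) (p q : ℝ) :
    p * outcome out true q + (1 - p) * outcome out b q = outcome out b (q * (1 - p)) := by
  cases out <;> cases b <;> simp [outcome] <;> ring

-- The continuation depends on the outcomes only through the flag and the scalar amplitude, so
-- summing squared amplitudes gives a mixture of "found" with weight `1 - failProb θ it` and
-- "unchanged" with weight `failProb θ it`.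
open Classical in
theorem HasVal.round {h it sc rc t : ℕ} {l : List Prog} {q θ : ℝ} (hK : Fits K w h) (hit : it < 2 ^ w)
    (hθ : IsSearchAngle (Bad K h (w := w)) (6 * h) θ)
    (H : HasVal K h (Counters w (2 * it + 1) sc rc) t l q) :
    HasVal K h (Counters w it (sc + 1) rc) (t + roundTime h it) (roundProg :: l)
      (q * failProb θ it) := by
  rintro σ b a hσ ⟨h14, h15, h16⟩ out
  obtain ⟨σ₁, he, hr, ha⟩ := exec_searchProg hK hit σ hσ.good h14 hσ.amp
  rw [iterate_groverStep hθ] at ha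
  have hσ₁ : Good N h σ₁.reg := hσ.good.eqOff hr (by decide)
  rw [roundTime, ← add_assoc, roundProg, outProb, show t + (searchTime h it + readTime) =
    t + readTime + searchTime h it by ring, he, outProb_readProg]
  have key : ∀ f v : BitVec w, outProb K out t l (readState K σ₁ f v) =
      ‖if (if Bad K h v then 1#w else 0#w) = f then a * searchAmp (Bad K h) (6 * h) θ it v
        else 0‖ ^ 2 * outcome out (b || decide (f ≠ 0#w)) q := by
    intro f v
    obtain ⟨r1, r14, r15, r17, ramp⟩ := readState_spec hK σ₁ hσ₁ ha f v
    refine H _ _ _ ⟨hσ₁.eqOff r1 (by decide), ?_, ramp⟩ ⟨?_, ?_, ?_⟩ out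
    · have e17 : σ₁.reg 17 = σ.reg 17 := hr 17 (by decide)
      rw [r17, e17, Bool.or_eq_true, ← hσ.found, decide_eq_true_iff, Ne,
        BitVec.or_eq_zero_iff]
      exact not_and_or
    · rw [r14, hr 14 (by decide), h14, two_mul, BitVec.ofNat_add, BitVec.ofNat_add]
    · rw [r15, hr 15 (by decide), h15]
      exact ofNat_sub_one (by omega)
    · rw [r1 16 (by decide), hr 16 (by decide), h16]
  simp only [key]
  rw [Finset.sum_comm]
  have hw : 0 < w := by have := hK.six_le; omega
  have inner : ∀ v : BitVec w, (∑ f : BitVec w,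
      ‖if (if Bad K h v then 1#w else 0#w) = f then a * searchAmp (Bad K h) (6 * h) θ it v
        else 0‖ ^ 2 * outcome out (b || decide (f ≠ 0#w)) q) =
      ‖a‖ ^ 2 * (‖searchAmp (Bad K h) (6 * h) θ it v‖ ^ 2 *
        (if Bad K h v then outcome out true q else outcome out b q)) := by
    intro v
    -- Given `v`, the predicate outcome is determined; all other `f` have amplitude zero.
    rw [Finset.sum_eq_single (if Bad K h v then 1#w else 0#w)]
    · rw [if_pos rfl, norm_mul, mul_pow, mul_assoc]
      by_cases hv : Bad K h v
      · simp [hv, hw.ne']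
      · simp [hv]
    · intro f _ hf
      rw [if_neg (Ne.symm hf)]
      simp
    · intro hf
      exact absurd (Finset.mem_univ _) hf
  rw [Finset.sum_congr rfl fun v _ => inner v, ← Finset.mul_sum, sum_searchAmp hθ, outcome_mix]
  rfl

open Classical in
theorem HasVal.loop {h rc t : ℕ} {l : List Prog} {q θ : ℝ} (hK : Fits K w h) (hw : 3 * h + 1 < w)
    (hθ : IsSearchAngle (Bad K h (w := w)) (6 * h) θ)
    (H : HasVal K h (fun ρ : ℕ → BitVec w => ρ 16 = BitVec.ofNat w rc) t l q) (r s : ℕ)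
    (hrs : s + r = 3 * h + 1) :
    HasVal K h (Counters w (2 ^ s - 1) r rc) (t + loopTime h s r) (.loop 15 roundProg :: l)
      (q * ∏ i ∈ Finset.Ico s (3 * h + 1), failProb θ (2 ^ i - 1)) := by
  induction r generalizing s with
  | zero =>
    obtain rfl : s = 3 * h + 1 := by omega
    rintro σ b a hσ ⟨-, h15, h16⟩ out
    rw [Finset.Ico_self, Finset.prod_empty, mul_one, loopTime, exec_loop_done (by simpa using h15)]
    exact H σ b a hσ h16 out
  | succ r ih =>
    have h2 : (2 ^ s - 1 : ℕ) < 2 ^ w :=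
      lt_of_le_of_lt (Nat.sub_le _ _) (Nat.pow_lt_pow_right (by norm_num) (by omega))
    have key := ih (s + 1) (by omega)
    -- This matches the update of `c[14]` at the end of a round.
    have hs : 2 ^ (s + 1) - 1 = 2 * (2 ^ s - 1) + 1 := by
      have := Nat.one_le_two_pow (n := s)
      rw [pow_succ]
      omega
    rw [hs] at key
    have key2 := key.round hK h2 hθ
    rintro σ b a hσ hc out
    have h15 : σ.reg 15 ≠ 0#w := by
      rw [hc.2.1]
      exact ofNat_ne_zero (by omega) (lt_two_pow_of_le (by omega))
    rw [loopTime, ← add_assoc, ← add_assoc, outProb, if_pos h15, key2 σ b a hσ hc out,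
      Finset.prod_eq_prod_Ico_succ_bot (by omega : s < 3 * h + 1), mul_assoc,
      mul_comm (failProb θ _)]

open Classical in
theorem HasVal.sweep {h rc t : ℕ} {l : List Prog} {q θ : ℝ} (hK : Fits K w h) (hw : 3 * h + 1 < w)
    (hθ : IsSearchAngle (Bad K h (w := w)) (6 * h) θ)
    (H : HasVal K h (fun ρ : ℕ → BitVec w => ρ 16 = BitVec.ofNat w rc) t l q) :
    HasVal K h (fun ρ : ℕ → BitVec w => ρ 16 = BitVec.ofNat w rc) (t + sweepTime h)
      (sweepProg :: l) (q * ∏ i ∈ Finset.range (3 * h + 1), failProb θ (2 ^ i - 1)) := by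
  rintro σ b a hσ h16 out
  have key := H.loop hK hw hθ (3 * h + 1) 0 (by omega)
  have h100 : σ.reg 100 = 0#w := hσ.good.addr 0 (by norm_num)
  rw [sweepTime, ← add_assoc, sweepProg]
  refine (outProb_block out _ [.const 14 0, .arith .add 9 100 15] _ l σ).trans ?_
  rw [Finset.range_eq_Ico]
  refine key (execList K [.const 14 0, .arith .add 9 100 15] σ) b a ⟨?_, ?_, hσ.amp⟩ ⟨?_, ?_, ?_⟩ out
  · exact hσ.good.eqOff (((EqOff.refl {14, 15} _).update (by decide) _).update (by decide) _)
      (by decide)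
  · simpa [execList, Instr.exec] using hσ.found
  · simp [execList, Instr.exec]
  · simp [execList, Instr.exec, WordOp.eval, h100, hσ.good.rounds]
  · simp [execList, Instr.exec, h16]

theorem hasVal_final {h t : ℕ} (P : (ℕ → BitVec w) → Prop) (hw : 0 < w) :
    HasVal K h P (t + 1) [.instr (.arith .eq 17 100 0)] 1 := by
  rintro σ b a hσ - out
  have h100 : σ.reg 100 = 0#w := hσ.good.addr 0 (by norm_num)
  have hnorm : normSq σ.amp = ‖a‖ ^ 2 := by
    rw [normSq, Finset.sum_eq_single (embed 0#w), hσ.amp, emb_embed]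
    · simp
    · intro m _ hm
      rw [hσ.amp]
      by_cases h0 : m 0#w = 0#w
      · have : ¬ m = embed (m 0#w) := by rwa [h0]
        simp [emb, this]
      · simp [emb, h0]
    · intro hm
      exact absurd (Finset.mem_univ _) hm
  rw [outProb, outProb]
  have h0 : ((Instr.arith .eq 17 100 0).exec K σ).reg 0 = if σ.reg 17 = 0#w then 1#w else 0#w := by
    simp [Instr.exec, WordOp.eval, h100]
  have hamp : ((Instr.arith .eq 17 100 0).exec K σ).amp = σ.amp := rfl
  rw [h0, hamp, hnorm]
  have hb := hσ.found
  cases b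
  · have : σ.reg 17 = 0#w := by simpa using hb
    cases out <;> simp [this, outcome, hw.ne']
  · have : σ.reg 17 ≠ 0#w := by simpa using hb
    cases out <;> simp [this, outcome]

open Classical in
theorem hasVal_outer {h : ℕ} {θ : ℝ} (hK : Fits K w h) (hw : 3 * h + 1 < w)
    (hθ : IsSearchAngle (Bad K h (w := w)) (6 * h) θ) (t R : ℕ) (hR : R < 2 ^ w) :
    HasVal K h (fun ρ : ℕ → BitVec w => ρ 16 = BitVec.ofNat w R)
      (t + (1 + 1 + R * (sweepTime h + 3)))
      [outerProg, .instr (.arith .eq 17 100 0)]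
      ((∏ i ∈ Finset.range (3 * h + 1), failProb θ (2 ^ i - 1)) ^ R) := by
  induction R with
  | zero =>
    rintro σ b a hσ h16 out
    rw [zero_mul, add_zero, ← add_assoc, outerProg, exec_loop_done (by simpa using h16), pow_zero]
    exact hasVal_final (fun _ => True) (by omega) σ b a hσ trivial out
  | succ R ih =>
    have key : HasVal K h (fun ρ : ℕ → BitVec w => ρ 16 = BitVec.ofNat w (R + 1))
        (t + (1 + 1 + R * (sweepTime h + 3)) + 1)
        [.instr (.arith .sub 16 101 16), outerProg, .instr (.arith .eq 17 100 0)]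
        ((∏ i ∈ Finset.range (3 * h + 1), failProb θ (2 ^ i - 1)) ^ R) := by
      rintro σ b a hσ h16 out
      have h101 : σ.reg 101 = BitVec.ofNat w 1 := hσ.good.addr 1 (by norm_num)
      rw [outProb]
      refine ih (by omega) ((Instr.arith .sub 16 101 16).exec K σ) b a ⟨?_, ?_, hσ.amp⟩ ?_ out
      · exact hσ.good.eqOff ((EqOff.refl {16} _).update (by decide) _) (by decide)
      · simpa [Instr.exec] using hσ.found
      · simp only [Instr.exec, Function.update_self, WordOp.eval]
        rw [h16, h101, ofNat_sub_one (by omega)]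
        rfl
    rintro σ b a hσ h16 out
    have h16' : σ.reg 16 ≠ 0#w := by
      rw [h16]
      exact ofNat_ne_zero (by omega) hR
    have e : t + (1 + 1 + (R + 1) * (sweepTime h + 3)) =
        t + (1 + 1 + R * (sweepTime h + 3)) + 1 + sweepTime h + 1 + 1 := by ring
    rw [e, outerProg, outProb, if_pos h16', outProb, pow_succ]
    exact (key.sweep hK hw hθ) σ b a hσ h16 out

end
end QRam
namespace QRam

/-! ### The whole program -/

def metricTime (d h : ℕ) : ℕ :=
  1 + 1 + d * (2 * h) * (sweepTime h + 3) + 1 + 2 * setSizes.length + (h * (1 + 2 * 1 + 1) + 1) + 1 +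
    2 * 3 + 2 * setAddrs.length

section
variable {N : ℕ} {K : Matrix (Fin N) (Fin N) ℤ} {w : ℕ}

theorem execList_setAddrs (n : ℕ) (σ : State w) :
    execList K ((List.range n).map fun k => .const (100 + k) k) σ =
      ⟨fun r => if 100 ≤ r ∧ r < 100 + n then BitVec.ofNat w (r - 100) else σ.reg r, σ.amp⟩ := by
  induction n with
  | zero =>
    have : ∀ r, ¬ (100 ≤ r ∧ r < 100 + 0) := fun r => by omega
    simp only [this, if_false]
    rfl
  | succ n ih =>
    rw [List.range_succ, List.map_append, execList_append, ih]
    simp only [List.map, execList, List.foldl, Instr.exec]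
    congr 1
    funext r
    by_cases hr : r = 100 + n
    · subst hr
      rw [Function.update_self, if_pos (by omega), Nat.add_sub_cancel_left]
    · rw [Function.update_of_ne hr]
      exact if_congr (by omega) rfl rfl

/-- A right shift by two bits divides by `4`, so the number of passes is the number of base `4`
digits of `N`. -/
theorem exec_digitsProg (hN : N ≠ 0) (hNw : N < 2 ^ w) (hw : 6 ≤ w) (σ : State w) (hσ : Addr σ.reg)
    (h5 : σ.reg 5 = BitVec.ofNat w 0) (h20 : σ.reg 20 = BitVec.ofNat w N) :
    ∃ σ', Exec K digitsProg ((Nat.log 4 N + 1) * (1 + 2 * 1 + 1) + 1) σ σ' ∧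
      EqOff {5, 20} σ.reg σ'.reg ∧ σ'.reg 5 = BitVec.ofNat w (Nat.log 4 N + 1) ∧
      σ'.amp = σ.amp := by
  have h101 : σ.reg 101 = BitVec.ofNat w 1 := hσ 1 (by norm_num)
  have h102 : σ.reg 102 = BitVec.ofNat w 2 := hσ 2 (by norm_num)
  have h64 : 64 ≤ 2 ^ w := le_trans (by norm_num) (Nat.pow_le_pow_right two_pos hw)
  let I : ℕ → State w → Prop := fun i τ => EqOff {5, 20} σ.reg τ.reg ∧
    τ.reg 5 = BitVec.ofNat w i ∧ τ.reg 20 = BitVec.ofNat w (N / 4 ^ i) ∧ τ.amp = σ.amp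
  have hstep : ∀ i < Nat.log 4 N + 1, ∀ τ, I i τ → τ.reg 20 ≠ 0#w ∧ ∃ τ', Exec K
      (block [.arith .shr 20 102 20] (.instr (.arith .add 5 101 5))) (1 + 2 * 1) τ τ' ∧
        I (i + 1) τ' := by
    rintro i hi τ ⟨hτ, t5, t20, ha⟩
    have t101 : τ.reg 101 = BitVec.ofNat w 1 := (hτ 101 (by decide)).trans h101
    have t102 : τ.reg 102 = BitVec.ofNat w 2 := (hτ 102 (by decide)).trans h102
    have hlt : N / 4 ^ i < 2 ^ w := (Nat.div_le_self _ _).trans_lt hNw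
    refine ⟨t20 ▸ ofNat_ne_zero ?_ hlt, _, exec_block_instr _ _ _, ?_⟩
    · exact (Nat.div_pos (Nat.pow_le_of_le_log hN (by omega)) (by positivity)).ne'
    · simp only [execList, List.foldl, Instr.exec, I]
      refine ⟨(hτ.update (by decide) _).update (by decide) _, ?_, ?_, ha⟩
      · simp [WordOp.eval, t5, t101, BitVec.ofNat_add]
      · rw [Function.update_of_ne (by decide), Function.update_self, WordOp.eval, t20, t102,
          BitVec.toNat_eq, BitVec.toNat_ushiftRight, BitVec.toNat_ofNat, BitVec.toNat_ofNat,
          BitVec.toNat_ofNat, Nat.mod_eq_of_lt hlt, Nat.mod_eq_of_lt (by omega : 2 < 2 ^ w),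
          Nat.mod_eq_of_lt ((Nat.div_le_self _ _).trans_lt hNw), Nat.shiftRight_eq_div_pow,
          pow_succ 4 i, Nat.div_div_eq_div_mul]
  have hend : ∀ τ, I (Nat.log 4 N + 1) τ → τ.reg 20 = 0#w := by
    rintro τ ⟨-, -, t20, -⟩
    rw [t20, Nat.div_eq_of_lt (Nat.lt_pow_succ_log_self (by norm_num) N)]
  have hstart : I 0 σ := ⟨EqOff.refl _ _, h5, by simpa using h20, rfl⟩
  obtain ⟨σ', he, hr, h5', -, ha⟩ := exec_loop I (Nat.log 4 N + 1) _ hstep hend _ hstart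
  exact ⟨σ', he, hr, h5', ha⟩

theorem ready_setSizes {h d : ℕ} (hh : 2 * h ≤ w) (σ : State w) (hσ : Addr σ.reg)
    (h0 : σ.reg 0 = BitVec.ofNat w N) (h5 : σ.reg 5 = BitVec.ofNat w h)
    (h10 : σ.reg 10 = BitVec.ofNat w d) (h17 : σ.reg 17 = 0#w)
    (ha : σ.amp = emb fun x => 1 * if x = 0#w then 1 else 0) :
    Ready N h false 1 (execList K setSizes σ) ∧
      (execList K setSizes σ).reg 16 = BitVec.ofNat w (d * (2 * h)) := by
  have h101 : σ.reg 101 = BitVec.ofNat w 1 := hσ 1 (by norm_num)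
  have h102 : σ.reg 102 = BitVec.ofNat w 2 := hσ 2 (by norm_num)
  have h103 : σ.reg 103 = BitVec.ofNat w 3 := hσ 3 (by norm_num)
  have h106 : σ.reg 106 = BitVec.ofNat w 6 := hσ 6 (by norm_num)
  have hmul : ∀ a b : ℕ, BitVec.ofNat w a * BitVec.ofNat w b = BitVec.ofNat w (a * b) :=
    fun a b => (BitVec.ofNat_mul a b).symm
  have hshl : BitVec.ofNat w 1 <<< (BitVec.ofNat w (2 * h)).toNat = BitVec.ofNat w (4 ^ h) := by
    rw [BitVec.toNat_ofNat, Nat.mod_eq_of_lt (lt_two_pow_of_le hh), BitVec.toNat_eq,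
      BitVec.toNat_shiftLeft, BitVec.toNat_ofNat, BitVec.toNat_ofNat, Nat.shiftLeft_eq,
      Nat.mod_mul_mod, one_mul, pow_mul]
    norm_num
  refine ⟨⟨⟨?_, ?_, ?_, ?_, ?_, ?_⟩, ?_, ha⟩, ?_⟩
  · intro k hk
    rw [← hσ k hk]
    simp only [execList, setSizes, List.foldl, Instr.exec]
    rw [Function.update_of_ne (by omega), Function.update_of_ne (by omega),
      Function.update_of_ne (by omega), Function.update_of_ne (by omega),
      Function.update_of_ne (by omega), Function.update_of_ne (by omega),
      Function.update_of_ne (by omega)]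
  · simp [execList, setSizes, Instr.exec, h0]
  · simp [execList, setSizes, Instr.exec, WordOp.eval, h102, h5, hmul]
  · simp [execList, setSizes, Instr.exec, WordOp.eval, h106, h5, hmul]
  · simp only [execList, setSizes, List.foldl, Instr.exec, WordOp.eval, Function.update_self, ne_eq,
      Nat.reduceEqDiff, not_false_eq_true, Function.update_of_ne]
    rw [h101, h102, h5, hmul, hshl, ofNat_sub_one (by positivity)]
  · simp [execList, setSizes, Instr.exec, WordOp.eval, h103, h5, h101, hmul, BitVec.ofNat_add]
  · simp [execList, setSizes, Instr.exec, h17]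
  · simp [execList, setSizes, Instr.exec, WordOp.eval, h102, h10, h5, hmul]

open Classical in
theorem outProb_metricProg {d : ℕ} {θ : ℝ} (hN : N ≠ 0) (hK : Fits K w (Nat.log 4 N + 1))
    (hw : 3 * (Nat.log 4 N + 1) + 1 < w) (hR : d * (2 * (Nat.log 4 N + 1)) < 2 ^ w)
    (hθ : IsSearchAngle (Bad K (Nat.log 4 N + 1) (w := w)) (6 * (Nat.log 4 N + 1)) θ) (t : ℕ)
    (out : Bool) :
    outProb K out (t + metricTime d (Nat.log 4 N + 1)) [metricProg d] (initial w N) =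
      outcome out false ((∏ i ∈ Finset.range (3 * (Nat.log 4 N + 1) + 1),
        failProb θ (2 ^ i - 1)) ^ (d * (2 * (Nat.log 4 N + 1)))) := by
  have hbits := hK.bits_le
  have hNw : N < 2 ^ w := by
    refine hK.size_lt.trans_le ?_
    have e4 : 4 ^ (Nat.log 4 N + 1) = 2 ^ (2 * (Nat.log 4 N + 1)) := by rw [pow_mul]; norm_num
    rw [e4]
    exact Nat.pow_le_pow_right two_pos (by omega)
  obtain ⟨σ₁, hσ₁⟩ : ∃ σ₁, σ₁ = execList K setAddrs (initial w N) := ⟨_, rfl⟩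
  obtain ⟨σ₂, hσ₂⟩ : ∃ σ₂, σ₂ = execList K [.const 10 d, .const 5 0, .arith .add 0 100 20] σ₁ :=
    ⟨_, rfl⟩
  have e1 := hσ₁.trans (execList_setAddrs (K := K) 64 (initial w N))
  have a1 : Addr σ₁.reg := by
    intro k hk
    rw [e1]
    simp only
    rw [if_pos (by omega), Nat.add_sub_cancel_left]
  have r2 : EqOff {5, 10, 20} σ₁.reg σ₂.reg := hσ₂ ▸
    (((EqOff.refl _ _).update (by decide) _).update (by decide) _).update (by decide) _
  have a2 : Addr σ₂.reg := by
    intro k hk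
    rw [r2 _ (by simp; omega), a1 k hk]
  have hr : ∀ r < 100, σ₁.reg r = (initial w N).reg r := by
    intro r hr
    rw [e1]
    simp only
    rw [if_neg (by omega)]
  have h100 : σ₁.reg 100 = 0#w := a1 0 (by norm_num)
  have amp2 : σ₂.amp = emb fun x => 1 * if x = 0#w then 1 else 0 := by
    have : σ₂.amp = σ₁.amp := by rw [hσ₂]; rfl
    rw [this, e1]
    funext m
    simp only [initial, emb]
    by_cases hm : m = fun _ => 0#w
    · simp [hm, embed]
    · rw [if_neg hm]
      by_cases h0 : m 0#w = 0#w
      · rw [if_neg]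
        intro h
        apply hm
        rw [h, h0]
        funext a
        simp [embed]
      · simp [h0]
  obtain ⟨σ₃, he3, r3, h5, amp3⟩ := exec_digitsProg (K := K) hN hNw hK.six_le σ₂ a2
    (by simp [hσ₂, execList, Instr.exec])
    (by simp [hσ₂, execList, Instr.exec, WordOp.eval, h100, hr, initial])
  have a3 : Addr σ₃.reg := by
    intro k hk
    rw [r3 _ (by simp; omega), a2 k hk]
  obtain ⟨hready, h16⟩ := ready_setSizes (K := K) (d := d) (by omega) σ₃ a3
    (by rw [r3 0 (by decide), r2 0 (by decide), hr 0 (by decide)]; simp [initial]) h5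
    (by rw [r3 10 (by decide)]; simp [hσ₂, execList, Instr.exec])
    (by rw [r3 17 (by decide), r2 17 (by decide), hr 17 (by decide)]; simp [initial])
    (amp3.trans amp2)
  have key := hasVal_outer hK hw hθ t _ hR _ false 1 hready h16 out
  obtain ⟨T, hT⟩ : ∃ T, T = t + (1 + 1 + d * (2 * (Nat.log 4 N + 1)) *
    (sweepTime (Nat.log 4 N + 1) + 3)) := ⟨_, rfl⟩
  obtain ⟨D, hD⟩ : ∃ D, D = (Nat.log 4 N + 1) * (1 + 2 * 1 + 1) + 1 := ⟨_, rfl⟩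
  rw [← hT] at key
  rw [← hD] at he3
  have e : t + metricTime d (Nat.log 4 N + 1) =
      T + 1 + 2 * setSizes.length + D + 1 + 2 * 3 + 2 * setAddrs.length := by
    rw [metricTime, hT, hD]
    ring
  rw [e, metricProg, outProb_block, ← hσ₁]
  refine (outProb_block out _ [.const 10 d, .const 5 0, .arith .add 0 100 20] _ _ σ₁).trans ?_
  rw [← hσ₂, outProb, he3, outProb_block, outProb, key, norm_one, one_pow, one_mul]

end

/-! ### Bounds for the running time. -/

/-- A geometric sum: the cost of a sweep is dominated by its longest round. The term `2 ^ s * A` on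
the left avoids a subtraction. -/
theorem loopTime_le (h s r A : ℕ) (hA : ∀ s, roundTime h (2 ^ s - 1) + 1 ≤ 2 ^ s * A) :
    loopTime h s r + 2 ^ s * A ≤ 1 + 2 ^ (s + r) * A := by
  induction r generalizing s with
  | zero => simp [loopTime]
  | succ r ih =>
    have h1 := ih (s + 1)
    have h2 := hA s
    rw [show s + 1 + r = s + (r + 1) by ring, pow_succ 2 s] at h1
    rw [loopTime]
    nlinarith

theorem roundTime_le {h : ℕ} (hh : 1 ≤ h) (s : ℕ) :
    roundTime h (2 ^ s - 1) + 1 ≤ 2 ^ s * (500 * h) := by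
  have h1 : (kick badOps 29).length = 62 := rfl
  have h2 : (kick zeroOps 2).length = 8 := rfl
  have h3 : readTime = 129 := rfl
  have h4 := Nat.one_le_two_pow (n := s)
  obtain ⟨m, hm⟩ : ∃ m, 2 ^ s = m + 1 := ⟨2 ^ s - 1, by omega⟩
  rw [hm, Nat.add_sub_cancel, roundTime, searchTime, stepTime, upTime, downTime, h1, h2, h3]
  nlinarith

theorem metricTime_le {d h : ℕ} (hh : 1 ≤ h) :
    metricTime d h ≤ 3000 * (d + 1) * h ^ 2 * 8 ^ h := by
  have h1 := loopTime_le h 0 (3 * h + 1) (500 * h) (roundTime_le hh)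
  have h8 : 2 ^ (0 + (3 * h + 1)) = 2 * 8 ^ h := by
    rw [zero_add, pow_succ, pow_mul, mul_comm]
    norm_num
  rw [h8] at h1
  have h3 : 1 ≤ 8 ^ h := Nat.one_le_pow _ _ (by norm_num)
  have h4 : h ≤ h * 8 ^ h := Nat.le_mul_of_pos_right _ (by omega)
  -- Here `1008 = 2 * 500 + 8`, where the `8` absorbs the additive constants.
  have h5 : sweepTime h + 3 ≤ 1008 * (h * 8 ^ h) := by
    rw [sweepTime]
    nlinarith
  have h6 : d * (2 * h) * (sweepTime h + 3) ≤ d * (2 * h) * (1008 * (h * 8 ^ h)) :=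
    Nat.mul_le_mul_left _ h5
  have h7 : h ≤ h ^ 2 * 8 ^ h := by
    calc h ≤ h * 8 ^ h := h4
      _ ≤ h ^ 2 * 8 ^ h := Nat.mul_le_mul_right _ (by nlinarith)
  have h10 : setSizes.length = 7 := rfl
  have h11 : setAddrs.length = 64 := by simp [setAddrs]
  rw [metricTime, h10, h11]
  have h8 : d * (2 * h) * (1008 * (h * 8 ^ h)) = 2016 * (d * (h ^ 2 * 8 ^ h)) := by ring
  have h9 : 3000 * (d + 1) * h ^ 2 * 8 ^ h =
      3000 * (d * (h ^ 2 * 8 ^ h)) + 3000 * (h ^ 2 * 8 ^ h) := by ring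
  rw [h8] at h6
  rw [h9]
  omega

/-- With `ℓ = Nat.log 4 N`, one has `8 ^ ℓ = (4 ^ ℓ) ^ (3 / 2) ≤ N ^ (3 / 2)`. The constant is
`216000 = 3000 * 9 * 8`: the `9` comes from `ℓ + 1 ≤ 3 * log (N + 1)`, squared, and the `8` from `8
^ (ℓ + 1)`. -/
theorem metricTime_le_real {N : ℕ} (hN : 1 ≤ N) (d : ℕ) :
    (metricTime d (Nat.log 4 N + 1) : ℝ) ≤
      ((216000 * (d + 1) : ℕ) : ℝ) * (N : ℝ) ^ (3 / 2 : ℝ) * Real.log ((N : ℝ) + 1) ^ 2 := by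
  have hle : (4 : ℝ) ^ Nat.log 4 N ≤ N := by
    exact_mod_cast Nat.pow_log_le_self 4 (by omega : N ≠ 0)
  have hN' : (1 : ℝ) ≤ N := by exact_mod_cast hN
  have h8 : (8 : ℝ) ^ Nat.log 4 N ≤ (N : ℝ) ^ (3 / 2 : ℝ) := by
    have e : (8 : ℝ) ^ Nat.log 4 N = ((4 : ℝ) ^ Nat.log 4 N) ^ (3 / 2 : ℝ) := by
      have e8 : (8 : ℝ) = (4 : ℝ) ^ (3 / 2 : ℝ) := by
        rw [show (4 : ℝ) = 2 ^ (2 : ℝ) by norm_num, ← Real.rpow_mul (by norm_num)]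
        norm_num
      rw [e8, ← Real.rpow_natCast, ← Real.rpow_natCast, ← Real.rpow_mul (by norm_num),
        ← Real.rpow_mul (by norm_num), mul_comm]
    rw [e]
    exact Real.rpow_le_rpow (by positivity) hle (by norm_num)
  have hlog : ((Nat.log 4 N + 1 : ℕ) : ℝ) ≤ 3 * Real.log ((N : ℝ) + 1) := by
    have h1 : (Nat.log 4 N : ℝ) * Real.log 4 ≤ Real.log ((N : ℝ) + 1) := by
      rw [← Real.log_pow]
      exact Real.log_le_log (by positivity) (by linarith)
    have h2 : Real.log 2 ≤ Real.log ((N : ℝ) + 1) := Real.log_le_log (by norm_num) (by linarith)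
    have h4 : Real.log 4 = 2 * Real.log 2 := by
      rw [show (4 : ℝ) = 2 ^ 2 by norm_num, Real.log_pow]
      norm_num
    have h3 := Real.log_two_gt_d9
    have h5 : (0 : ℝ) ≤ Nat.log 4 N := Nat.cast_nonneg _
    push_cast
    nlinarith
  have hnat : (metricTime d (Nat.log 4 N + 1) : ℝ) ≤
      3000 * ((d : ℝ) + 1) * ((Nat.log 4 N + 1 : ℕ) : ℝ) ^ 2 * (8 * 8 ^ Nat.log 4 N) := by
    have := metricTime_le (d := d) (h := Nat.log 4 N + 1) (by omega)
    have h' : (metricTime d (Nat.log 4 N + 1) : ℝ) ≤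
        ((3000 * (d + 1) * (Nat.log 4 N + 1) ^ 2 * 8 ^ (Nat.log 4 N + 1) : ℕ) : ℝ) := by
      exact_mod_cast this
    refine h'.trans_eq ?_
    push_cast
    ring
  have hsq : ((Nat.log 4 N + 1 : ℕ) : ℝ) ^ 2 ≤ 9 * Real.log ((N : ℝ) + 1) ^ 2 := by
    refine (pow_le_pow_left₀ (Nat.cast_nonneg _) hlog 2).trans_eq ?_
    ring
  calc (metricTime d (Nat.log 4 N + 1) : ℝ)
      ≤ 3000 * ((d : ℝ) + 1) * ((Nat.log 4 N + 1 : ℕ) : ℝ) ^ 2 * (8 * 8 ^ Nat.log 4 N) := hnat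
    _ ≤ 3000 * ((d : ℝ) + 1) * (9 * Real.log ((N : ℝ) + 1) ^ 2) * (8 * (N : ℝ) ^ (3 / 2 : ℝ)) := by
        gcongr
    _ = _ := by push_cast; ring

/-! ### The failure probability of a sweep, and the main theorem. -/

theorem failProb_nonneg (θ : ℝ) (j : ℕ) : 0 ≤ failProb θ j :=
  sub_nonneg.2 (Real.sin_sq_le_one _)

theorem failProb_le_one (θ : ℝ) (j : ℕ) : failProb θ j ≤ 1 :=
  sub_le_self _ (sq_nonneg _)

/-- One well-chosen round contributes a factor of at most one half, and no other factor exceeds one.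
-/
theorem prod_failProb_le_half {w m : ℕ} {f : BitVec w → Prop} [DecidablePred f] {θ : ℝ}
    (hθ : IsSearchAngle f (2 * m) θ) (h0 : 0 ≤ θ) (hpi : θ ≤ Real.pi / 2)
    (hf : ∃ x ∈ below w (2 * m), f x) :
    ∏ i ∈ Finset.range (m + 1), failProb θ (2 ^ i - 1) ≤ 1 / 2 := by
  obtain ⟨s, hs, hs'⟩ := exists_half_le_sin_sq hθ h0 hpi hf
  rw [← Finset.mul_prod_erase _ _ (Finset.mem_range.2 (Nat.lt_succ_of_le hs))]
  calc failProb θ (2 ^ s - 1) * ∏ i ∈ (Finset.range (m + 1)).erase s, failProb θ (2 ^ i - 1)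
      ≤ 1 / 2 * 1 := by
        refine mul_le_mul ?_ ?_ ?_ (by norm_num)
        · rw [failProb]; linarith
        · exact Finset.prod_le_one (fun i _ => failProb_nonneg _ _) fun i _ => failProb_le_one _ _
        · exact Finset.prod_nonneg fun i _ => failProb_nonneg _ _
    _ = 1 / 2 := by norm_num

/-- Without marked words the angle is zero, so no round ever reports one: the error is one-sided. -/
theorem prod_failProb_eq_one {w L : ℕ} {f : BitVec w → Prop} [DecidablePred f] {θ : ℝ}
    (hθ : IsSearchAngle f L θ) (h0 : 0 ≤ θ) (hpi : θ ≤ Real.pi / 2)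
    (hf : ¬ ∃ x ∈ below w L, f x) (s : Finset ℕ) : ∏ i ∈ s, failProb θ (2 ^ i - 1) = 1 := by
  have h1 := hθ.card_pos
  have h2 : (below w L).filter f = ∅ := by
    rw [Finset.filter_eq_empty_iff]
    exact fun x hx hfx => hf ⟨x, hx, hfx⟩
  rw [h2, Finset.card_empty, Nat.cast_zero, zero_eq_mul] at h1
  have h3 : Real.sin θ = 0 := by
    rcases h1 with h1 | h1
    · exact absurd h1 (by positivity)
    · exact pow_eq_zero_iff two_ne_zero |>.1 h1
  have h4 : θ = 0 := by
    by_contra hne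
    exact (Real.sin_pos_of_pos_of_lt_pi (lt_of_le_of_ne h0 (Ne.symm hne))
      (by linarith [Real.pi_pos])).ne' h3
  refine Finset.prod_eq_one fun i _ => ?_
  simp [failProb, h4]

end QRam

theorem mainTheorem9 (d : ℕ) :
    ∃ (P : QRam.Prog) (κ C c : ℕ), ∀ (N : ℕ), 1 ≤ N →
      ∀ (K : Matrix (Fin N) (Fin N) ℤ) (M w : ℕ), (∀ i j, (K i j).natAbs ≤ M) →
        κ * Nat.size N + Nat.size M ≤ w →
        ∀ (t : ℕ), t = ⌊(C : ℝ) * (N : ℝ) ^ (3 / 2 : ℝ) * Real.log ((N : ℝ) + 1) ^ c⌋₊ →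
          QRam.runProb P w K t true + QRam.runProb P w K t false = 1 ∧
          (DefinesMetric K →
            1 - 1 / ((N : ℝ) + 1) ^ d ≤ QRam.runProb P w K t true) ∧
          (¬ DefinesMetric K →
            1 - 1 / ((N : ℝ) + 1) ^ d ≤ QRam.runProb P w K t false) := by
  classical
  -- In the word length, `10 * h` covers the `6 * h` search bits with room for the counters and the
  -- spare bits beside an entry; the summand `d` lets the sweep counter `2 * h * d` fit.
  refine ⟨QRam.metricProg d, 10 + d, 216000 * (d + 1), 2, ?_⟩
  intro N hN K M w hM hw t ht
  set h := Nat.log 4 N + 1 with hh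
  have hlt : N < 4 ^ h := Nat.lt_pow_succ_log_self (by norm_num) N
  have hsize : h ≤ Nat.size N := by
    have h1 : 4 ^ Nat.log 4 N ≤ N := Nat.pow_log_le_self 4 (by omega)
    have h2 : 4 ^ Nat.log 4 N < 2 ^ Nat.size N := h1.trans_lt (Nat.lt_size_self N)
    rw [show (4 : ℕ) = 2 ^ 2 by norm_num, ← pow_mul] at h2
    have h3 := (Nat.pow_lt_pow_iff_right (by norm_num)).1 h2
    rw [show 2 ^ 2 = 4 by norm_num] at h3
    omega
  have hw' : 10 * h + d + Nat.size M ≤ w := by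
    have : (10 + d) * h ≤ (10 + d) * Nat.size N := Nat.mul_le_mul_left _ hsize
    have h1 : 1 ≤ h := by omega
    nlinarith
  have hK : QRam.Fits K w h := by
    refine ⟨by omega, by omega, hlt, fun i j => ?_⟩
    exact ((hM i j).trans_lt (Nat.lt_size_self M)).trans_le
      (Nat.pow_le_pow_right two_pos (by omega))
  have hR : d * (2 * h) < 2 ^ w := by
    calc d * (2 * h) ≤ d * 2 ^ (2 * h) := Nat.mul_le_mul_left _ Nat.lt_two_pow_self.le
      _ < 2 ^ d * 2 ^ (2 * h) := Nat.mul_lt_mul_of_pos_right Nat.lt_two_pow_self (by positivity)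
      _ = 2 ^ (d + 2 * h) := (pow_add _ _ _).symm
      _ ≤ 2 ^ w := Nat.pow_le_pow_right two_pos (by omega)
  obtain ⟨θ, hθ, h0, hpi⟩ := QRam.exists_isSearchAngle (f := QRam.Bad K h) hK.bits_le
    (QRam.exists_not_bad hK.bits_le hlt)
  have hT : QRam.metricTime d h ≤ t := by
    rw [ht]
    exact Nat.le_floor (QRam.metricTime_le_real hN d)
  -- The program takes exactly `metricTime d h` units on every branch; the surplus `t'` does not
  -- matter.
  obtain ⟨t', rfl⟩ := Nat.exists_eq_add_of_le' hT
  have key := QRam.outProb_metricProg (d := d) (by omega) hK (by omega) hR hθ t'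
  simp only [QRam.runProb]
  rw [key true, key false]
  set Q := ∏ i ∈ Finset.range (3 * h + 1), QRam.failProb θ (2 ^ i - 1) with hQ
  refine ⟨by simp [QRam.outcome], fun hm => ?_, fun hm => ?_⟩
  · have hQ1 : Q = 1 := QRam.prod_failProb_eq_one hθ h0 hpi
      (fun hex => (QRam.exists_bad_iff hK.bits_le hlt).1 hex hm) _
    rw [hQ1, one_pow]
    exact sub_le_self _ (by positivity)
  -- The number of search bits is even, so the square root of the search space is the power `2 ^ (3
  -- * h)`, and `3 * h + 1` rounds suffice.
  · have e6 : 6 * h = 2 * (3 * h) := by ring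
    have hex := (QRam.exists_bad_iff hK.bits_le hlt).2 hm
    rw [e6] at hθ hex
    have hQ2 : Q ≤ 1 / 2 := QRam.prod_failProb_le_half hθ h0 hpi hex
    have hQ0 : 0 ≤ Q := Finset.prod_nonneg fun i _ => QRam.failProb_nonneg _ _
    have hN4 : ((N : ℝ) + 1) ≤ 2 ^ (2 * h) := by
      have : N + 1 ≤ 2 ^ (2 * h) := by rw [pow_mul]; exact hlt
      exact_mod_cast this
    have : Q ^ (d * (2 * h)) ≤ 1 / ((N : ℝ) + 1) ^ d := by
      calc Q ^ (d * (2 * h)) ≤ (1 / 2) ^ (d * (2 * h)) := pow_le_pow_left₀ hQ0 hQ2 _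
        _ = 1 / (2 ^ (2 * h)) ^ d := by rw [← pow_mul, mul_comm, div_pow, one_pow]
        _ ≤ 1 / ((N : ℝ) + 1) ^ d := by gcongr
    simp only [QRam.outcome]
    linarith
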